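/- **Flat initial condition, finite time kernel.** Let $a,b:\mathbb R\to\mathbb R$ be arbitrary functions (in the PushASEP model they are smooth and increasing with $a(0)=b(0)=0$, and particle $k$ jumps right at rate $\dot a(t)v_k$ and left at rate $\dot b(t)/v_k$). Take uniform rates $v_k=1$. Write $(n_1,t_1)\prec(n_2,t_2)$ if $n_1\le n_2$, $t_2\le t_1$ and the two pairs are different. $\Gamma_0$ and $\Gamma_1$ denote anticlockwise circles around $0$ and around $1$, respectively, of arbitrary radii in $(0,1)$. *Finite systems.* For the particles with labels $i\ge 1$ started from $y_i=-2i$, put $$\Psi^{n,t}_{n-l}(x)=\frac1{2\pi \mathrm i}\oint_{\Gamma_0}dz\,z^{x-y_l-1}e^{a(t)/z+b(t)z}\,\frac{(1-v_1z)\cdots(1-v_nz)}{(1-v_1z)\cdots(1-v_lz)},\qquad l\ge1,$$ let $V_n$ be the space of functions on $\mathbb Z$ spanned by $1,x,\dots,x^{n-1}$, and let $\Phi^{n,t}_{n-k}$, $1\le k\le n$, be functions on $\mathbb Z$ that span $V_n$ and satisfy $\sum_{x\in\mathbb Z}\Psi^{n,t}_{n-l}(x)\Phi^{n,t}_{n-k}(x)=\delta_{k,l}$,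 $1\le k,l\le n$ (absolutely convergent series). The kernel of this system is $$K^{\rm fin}((n_1,t_1),x_1;(n_2,t_2),x_2)=-\phi^{((n_1,t_1),(n_2,t_2))}(x_1,x_2)+\sum_{k=1}^{n_2}\Psi^{n_1,t_1}_{n_1-k}(x_1)\Phi^{n_2,t_2}_{n_2-k}(x_2),$$ $$\phi^{((n_1,t_1),(n_2,t_2))}(x_1,x_2)=\frac{1}{2\pi \mathrm i}\oint_{\Gamma_0}\frac{dz}{z^{x_2-x_1+1}}\,\frac{e^{(a(t_1)-a(t_2))/z}e^{(b(t_1)-b(t_2))z}}{(1-v_{n_1+1}z)\cdots(1-v_{n_2}z)}\,\mathbb 1_{[(n_1,t_1)\prec(n_2,t_2)]}.$$ For $N\in\mathbb N$ and $n_1,n_2\in\mathbb Z$ let $$K_N((n_1,t_1),x_1;(n_2,t_2),x_2)=K^{\rm fin}((n_1+N,t_1),x_1-2N;(n_2+N,t_2),x_2-2N).$$ *Claim.* For all $n\ge1$ and $t$ the functions $\Phi^{n,t}_{n-k}$, $1\le k\le n$, exist and are unique. Moreover, as $N\to\infty$, the kernels $K_N$ converge, up to the conjugation by $(-1)^{n_1-n_2}$,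 to the kernel for $y_i=-2i$, $i\in\mathbb Z$, $$K((n_1,t_1),x_1;(n_2,t_2),x_2)=-\frac{1}{2\pi \mathrm i}\oint_{\Gamma_0}dw\,\frac1{w^{x_1-x_2+1}}\Big(\frac{w}{1-w}\Big)^{n_2-n_1}\frac{e^{a(t_1)w+b(t_1)/w}}{e^{a(t_2)w+b(t_2)/w}}\,\mathbb 1_{[(n_1,t_1)\prec(n_2,t_2)]}$$ $$\qquad+\frac{-1}{2\pi \mathrm i}\oint_{\Gamma_1}dz\,\frac{e^{a(t_1)(1-z)+b(t_1)/(1-z)}}{e^{a(t_2)z+b(t_2)/z}}\,\frac{z^{n_1+n_2+x_2}}{(1-z)^{n_1+n_2+x_1+1}},$$ in the following two senses. 1. For all $x_1,x_2\in\mathbb Z$ and all pairs $(n_1,t_1),(n_2,t_2)\in\mathbb Z\times\mathbb R$ that are equal or comparable under $\prec$, $(-1)^{n_1-n_2}K_N((n_1,t_1),x_1;(n_2,t_2),x_2)\to K((n_1,t_1),x_1;(n_2,t_2),x_2)$. 2. For every $m\geq 0$, every space-like sequence $(n_1,t_1)\prec\cdots\prec(n_m,t_m)$ in $\mathbb Z\times\mathbb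 R$ and all $s_1,\dots,s_m\in\mathbb Z$, with $\tilde\chi_s((n_k,t_k))(x)=\mathbb 1(x<s_k)$, the Fredholm series of $\det(\mathbb 1-\tilde\chi_sK\tilde\chi_s)$ on $\ell^2(\{(n_1,t_1),\dots,(n_m,t_m)\}\times\mathbb Z)$ converges absolutely, so does that of $\det(\mathbb 1-\tilde\chi_sK_N\tilde\chi_s)$ for all large $N$, and $$\lim_{N\to\infty}\det(\mathbb 1-\tilde\chi_sK_N\tilde\chi_s)=\det(\mathbb 1-\tilde\chi_sK\tilde\chi_s).$$ -/

import Mathlib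

open scoped Real Topology
open Filter

noncomputable section

namespace PushASEP

/-- `(1 / 2πi) ∮ f(z) dz` over the anticlockwise circle `|z - c| = r`. -/
def contour (c : ℂ) (r : ℝ) (f : ℂ → ℂ) : ℂ :=
  (2 * (π : ℂ) * Complex.I)⁻¹ * ∮ z in C(c, r), f z

/-- The order on pairs (particle label, time):
`(n₁, t₁) ≺ (n₂, t₂)` iff `n₁ ≤ n₂`, `t₂ ≤ t₁` and the two pairs are not identical. -/
def Prec (p q : ℤ × ℝ) : Prop := p.1 ≤ q.1 ∧ q.2 ≤ p.2 ∧ p ≠ q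

/-- The space `V_n`, the span of the functions `x ↦ x ^ l * u ^ x` on `ℤ`, where `u` runs through
the distinct values among `v_1, …, v_n` and `0 ≤ l <` multiplicity of `u`. -/
def spaceV (v : ℤ → ℝ) (n : ℤ) : Submodule ℂ (ℤ → ℂ) :=
  Submodule.span ℂ {f | ∃ j ∈ Finset.Icc 1 n, ∃ l : ℕ,
    l < ((Finset.Icc 1 n).filter (fun i => v i = v j)).card ∧
    f = fun x : ℤ => (x : ℂ) ^ l * (v j : ℂ) ^ x}

/-- `psi v y a b ρ n t l x` is `Ψ^{n,t}_{n-l}(x)`, for the particle system with rates `v`, initial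
positions `y` and time-change functions `a`, `b`. The contour is `|z| = ρ`, where `ρ` is to be so
small that the circle encloses none of the points `1 / v_i`. -/
def psi (v : ℤ → ℝ) (y : ℤ → ℤ) (a b : ℝ → ℝ) (ρ : ℝ) (n : ℤ) (t : ℝ) (l x : ℤ) : ℂ :=
  contour 0 ρ fun z =>
    z ^ (x - y l - 1) * Complex.exp (a t / z + b t * z) *
      ((∏ i ∈ Finset.Icc 1 n, (1 - (v i : ℂ) * z)) / ∏ i ∈ Finset.Icc 1 l, (1 - (v i : ℂ) * z))

/-- The two requirements on the functions `Φ^{n,t}_{n-k}`, `1 ≤ k ≤ n` (here `F k`):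
`∑_{x ∈ ℤ} Ψ^{n,t}_{n-l}(x) Φ^{n,t}_{n-k}(x) = δ_{k,l}` for `1 ≤ k, l ≤ n`, the series being
absolutely convergent, and the span of the `Φ^{n,t}_{n-k}` is `V_n`. -/
def IsDualFamily (v : ℤ → ℝ) (y : ℤ → ℤ) (a b : ℝ → ℝ) (ρ : ℝ) (n : ℤ) (t : ℝ)
    (F : Finset.Icc (1 : ℤ) n → ℤ → ℂ) : Prop :=
  (∀ k l : Finset.Icc (1 : ℤ) n,
    HasSum (fun x : ℤ => psi v y a b ρ n t l x * F k x) (if k = l then 1 else 0)) ∧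
  Submodule.span ℂ (Set.range F) = spaceV v n

/-- `phi v y a b ρ n t k x` is `Φ^{n,t}_{n-k}(x)`: the family singled out by `IsDualFamily`. -/
def phi (v : ℤ → ℝ) (y : ℤ → ℤ) (a b : ℝ → ℝ) (ρ : ℝ) (n : ℤ) (t : ℝ) :
    Finset.Icc (1 : ℤ) n → ℤ → ℂ :=
  Classical.epsilon (IsDualFamily v y a b ρ n t)

open Classical in
/-- The transition function `φ^{((n₁,t₁),(n₂,t₂))}(x₁, x₂)`. -/
def transition (v : ℤ → ℝ) (a b : ℝ → ℝ) (ρ : ℝ) (p : ℤ × ℝ) (x₁ : ℤ) (q : ℤ × ℝ) (x₂ : ℤ) : ℂ :=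
  if Prec p q then
    contour 0 ρ fun z =>
      (z ^ (x₂ - x₁ + 1))⁻¹ *
        (Complex.exp ((a p.2 - a q.2) / z) * Complex.exp ((b p.2 - b q.2) * z) /
          ∏ i ∈ Finset.Ioc p.1 q.1, (1 - (v i : ℂ) * z))
  else 0

/-- The kernel `K((n₁,t₁),x₁; (n₂,t₂),x₂)` of the system of particles with labels `1, 2, …`,
rates `v_1, v_2, …` and initial positions `y_1 > y_2 > …`. -/
def kernel (v : ℤ → ℝ) (y : ℤ → ℤ) (a b : ℝ → ℝ) (ρ : ℝ)
    (p : ℤ × ℝ) (x₁ : ℤ) (q : ℤ × ℝ) (x₂ : ℤ) : ℂ :=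
  -transition v a b ρ p x₁ q x₂ +
    ∑ k : Finset.Icc (1 : ℤ) q.1, psi v y a b ρ p.1 p.2 k x₁ * phi v y a b ρ q.1 q.2 k x₂

/-- The kernel of the system with unit rates started from `y_i = -2 i`, `i ≥ 1`, seen from
particle `N`: labels are shifted by `N` and positions by `-2 N`. -/
def shiftedKernel (a b : ℝ → ℝ) (ρ : ℝ) (N : ℕ)
    (p : ℤ × ℝ) (x₁ : ℤ) (q : ℤ × ℝ) (x₂ : ℤ) : ℂ :=
  kernel (fun _ => 1) (fun i => -2 * i) a b ρ
    (p.1 + N, p.2) (x₁ - 2 * N) (q.1 + N, q.2) (x₂ - 2 * N)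

open Classical in
/-- The explicit kernel for the flat initial condition, with contours `|w| = r₀` and
`|z - 1| = r₁`. -/
def flatKernel (a b : ℝ → ℝ) (r₀ r₁ : ℝ)
    (p : ℤ × ℝ) (x₁ : ℤ) (q : ℤ × ℝ) (x₂ : ℤ) : ℂ :=
  -(if Prec p q then
      contour 0 r₀ fun w =>
        (w ^ (x₁ - x₂ + 1))⁻¹ * (w / (1 - w)) ^ (q.1 - p.1) *
          (Complex.exp (a p.2 * w + b p.2 / w) / Complex.exp (a q.2 * w + b q.2 / w))
    else 0) +
  -contour 1 r₁ fun z =>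
    Complex.exp (a p.2 * (1 - z) + b p.2 / (1 - z)) / Complex.exp (a q.2 * z + b q.2 / z) *
      (z ^ (p.1 + q.1 + x₂) / (1 - z) ^ (p.1 + q.1 + x₁ + 1))

section Fredholm

variable {X : Type*}

/-- `det [K(x_i, x_j)]_{1 ≤ i, j ≤ n}`. -/
def minorDet (K : X → X → ℂ) (n : ℕ) (x : Fin n → X) : ℂ :=
  (Matrix.of fun i j => K (x i) (x j)).det

/-- Absolute convergence of the Fredholm series of `K` with respect to counting measure. -/
def FredholmSummable (K : X → X → ℂ) : Prop :=
  (∀ n : ℕ, Summable fun x : Fin n → X => ‖minorDet K n x‖) ∧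
  Summable fun n : ℕ => (n.factorial : ℝ)⁻¹ * ∑' x : Fin n → X, ‖minorDet K n x‖

/-- The Fredholm determinant `det(1 - K)` on `ℓ²(X)`, given by its Fredholm series
`∑_n (-1)^n / n! ∑_{x_1, …, x_n ∈ X} det [K(x_i, x_j)]`. -/
def fredholmDet (K : X → X → ℂ) : ℂ :=
  ∑' n : ℕ, (-1) ^ n / (n.factorial : ℂ) * ∑' x : Fin n → X, minorDet K n x

end Fredholm

/-- The kernel `χ̃_s K χ̃_s` on `{p_1, …, p_m} × ℤ`, where `χ̃_s(p_k)(x) = 1` if `x < s_k` and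
`0` otherwise. -/
def cutKernel {m : ℕ} (p : Fin m → ℤ × ℝ) (s : Fin m → ℤ)
    (K : ℤ × ℝ → ℤ → ℤ × ℝ → ℤ → ℂ) (u w : Fin m × ℤ) : ℂ :=
  (if u.2 < s u.1 then 1 else 0) * K (p u.1) u.2 (p w.1) w.2 * (if w.2 < s w.1 then 1 else 0)

end PushASEP

end

namespace PushASEP

open Complex Metric Set

/-! Put G_t(z) = exp(a(t) z + b(t)/z) and v(z) = z (z - 1). After z ↦ 1/z, the function
Ψ^{n,t}_{n-l}(x) is the Laurent coefficient of index x + 2n of v^(n-l) G_t, which for l ≤ n is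
holomorphic off 0. The dual functions can therefore be written down (`dualFun`, j = n - k): they are
the moments over Γ₁ of w^(x+2n) G_t(w)⁻¹ v'(w) v(w)^(-j-1). Summing over x rebuilds v^(n-l) G_t from
its Laurent series, and the pairing collapses to the residue of v^(k-l-1) dv, which is δ_{kl}. The
pole of order j + 1 at w = 1 makes `dualFun` a polynomial of degree at most j in x. Biorthogonality
then gives linear independence, a dimension count gives the span, and uniqueness follows because
pairing with Ψ reads off coordinates.

Indexed by j = n₂ + N - k, the summands of K_N do not depend on N; only their number n₂ + N does. In
Ψ and in the transition function the circle has radius 1/ρ > 1. Shrinking it into the unit disc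
leaves a circle around 0 and one around 1. The products are summed as geometric series in v(z)/v(w),
where v(w) - v(z) = (w - z)(w + z - 1). For z around 1 only the root z = w contributes, and the
finite sum is exactly the residue at 1 of the transition function, so the two cancel
(`sum_contour_mul_contour`, `shiftedKernel_eq`). For z on a small circle around 0 the series
converges, and the other root z = 1 - w produces the Γ₁ term of the limit
(`hasSum_contour_mul_contour`).

For the determinants, the bounds on the summands are geometric in j, hence uniform in N. Conjugation
by weights u_k^x, with u_k decreasing along the space-like sequence, gives each column of the cut
kernel a factor 2^(-|x₂|) (`weighted_kernel_le`). Hadamard's inequality then dominates the Fredholm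
series, and dominated convergence passes to the limit (`tendsto_fredholmDet`). The sign (-1)^(n₁-n₂)
is a conjugation and leaves determinants unchanged. -/

/-! ### Calculus of normalized circle integrals. -/

lemma contour_congr {c : ℂ} {r : ℝ} {f g : ℂ → ℂ} (hr : 0 ≤ r)
    (h : ∀ z ∈ sphere c r, f z = g z) : contour c r f = contour c r g := by
  unfold contour
  rw [circleIntegral.integral_congr hr h]

lemma norm_contour_le {c : ℂ} {r M : ℝ} {f : ℂ → ℂ} (hr : 0 ≤ r)
    (h : ∀ z ∈ sphere c r, ‖f z‖ ≤ M) : ‖contour c r f‖ ≤ r * M := by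
  simpa [contour] using circleIntegral.norm_two_pi_i_inv_smul_integral_le_of_norm_le_const hr h

lemma contour_const_mul (c a : ℂ) (r : ℝ) (f : ℂ → ℂ) :
    contour c r (fun z => a * f z) = a * contour c r f := by
  simp only [contour, circleIntegral.integral_const_mul]
  ring

lemma contour_mul_const (c a : ℂ) (r : ℝ) (f : ℂ → ℂ) :
    contour c r (fun z => f z * a) = contour c r f * a := by
  simp_rw [mul_comm _ a]
  exact contour_const_mul c a r f

lemma contour_neg (c : ℂ) (r : ℝ) (f : ℂ → ℂ) :
    contour c r (fun z => -f z) = -contour c r f := by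
  simpa using contour_const_mul c (-1) r f

lemma contour_add {c : ℂ} {r : ℝ} {f g : ℂ → ℂ} (hr : 0 ≤ r)
    (hf : ContinuousOn f (sphere c r)) (hg : ContinuousOn g (sphere c r)) :
    contour c r (fun z => f z + g z) = contour c r f + contour c r g := by
  unfold contour
  rw [← mul_add, ← circleIntegral.integral_add (hf.circleIntegrable hr) (hg.circleIntegrable hr)]

lemma contour_sub {c : ℂ} {r : ℝ} {f g : ℂ → ℂ} (hr : 0 ≤ r)
    (hf : ContinuousOn f (sphere c r)) (hg : ContinuousOn g (sphere c r)) :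
    contour c r (fun z => f z - g z) = contour c r f - contour c r g := by
  unfold contour
  rw [← mul_sub, ← circleIntegral.integral_sub (hf.circleIntegrable hr) (hg.circleIntegrable hr)]

lemma contour_sum {ι : Type*} {s : Finset ι} {c : ℂ} {r : ℝ} {f : ι → ℂ → ℂ} (hr : 0 ≤ r)
    (hf : ∀ i ∈ s, ContinuousOn (f i) (sphere c r)) :
    contour c r (fun z => ∑ i ∈ s, f i z) = ∑ i ∈ s, contour c r (f i) := by
  unfold contour
  rw [circleIntegral.integral_fun_sum fun i hi => (hf i hi).circleIntegrable hr, Finset.mul_sum]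

/-- Deformation of the contour in an annulus. -/
lemma contour_eq_of_annulus {c : ℂ} {r R : ℝ} {f : ℂ → ℂ} {U : Set ℂ} (hU : IsOpen U)
    (hf : DifferentiableOn ℂ f U) (hr : 0 < r) (hrR : r ≤ R)
    (hsub : closedBall c R \ ball c r ⊆ U) : contour c R f = contour c r f := by
  unfold contour
  rw [Complex.circleIntegral_eq_of_differentiable_on_annulus_off_countable hr hrR countable_empty
    (hf.continuousOn.mono hsub)]
  exact fun z hz => hf.differentiableAt (hU.mem_nhds (hsub
    ⟨ball_subset_closedBall hz.1.1, fun h => hz.1.2 (ball_subset_closedBall h)⟩))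

lemma contour_eq_zero {c : ℂ} {r : ℝ} {f : ℂ → ℂ} {U : Set ℂ} (hU : IsOpen U)
    (hf : DifferentiableOn ℂ f U) (hr : 0 ≤ r) (hsub : closedBall c r ⊆ U) :
    contour c r f = 0 := by
  unfold contour
  rw [Complex.circleIntegral_eq_zero_of_differentiable_on_off_countable hr countable_empty
    (hf.continuousOn.mono hsub), mul_zero]
  exact fun z hz => hf.differentiableAt (hU.mem_nhds (hsub (ball_subset_closedBall hz.1)))

/-- Cauchy's integral formula. -/
lemma contour_div_sub {c p : ℂ} {r : ℝ} {f : ℂ → ℂ} {U : Set ℂ}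
    (hf : DifferentiableOn ℂ f U) (hsub : closedBall c r ⊆ U) (hp : p ∈ ball c r) :
    contour c r (fun z => f z / (z - p)) = f p := by
  have := (hf.mono hsub).circleIntegral_sub_inv_smul hp
  unfold contour
  simp only [smul_eq_mul] at this
  simp_rw [div_eq_inv_mul]
  rw [this, ← mul_assoc, inv_mul_cancel₀ Complex.two_pi_I_ne_zero, one_mul]

lemma contour_inv_sub {c p : ℂ} {r : ℝ} (hp : p ∈ ball c r) :
    contour c r (fun z => (z - p)⁻¹) = 1 := by
  simpa using contour_div_sub (f := fun _ => 1) (differentiableOn_const 1) (subset_univ _) hp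

lemma contour_sub_zpow {c p : ℂ} {r : ℝ} {n : ℤ} (hn : n ≠ -1) :
    contour c r (fun z => (z - p) ^ n) = 0 := by
  unfold contour
  rw [circleIntegral.integral_sub_zpow_of_ne hn, mul_zero]

/-- Cauchy's integral formula in an annulus. -/
lemma contour_sub_contour_div_sub {c p : ℂ} {r R : ℝ} {f : ℂ → ℂ} {U : Set ℂ} (hU : IsOpen U)
    (hf : DifferentiableOn ℂ f U) (hr : 0 < r) (hsub : closedBall c R \ ball c r ⊆ U)
    (hpR : p ∈ ball c R) (hpr : p ∉ closedBall c r) :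
    contour c R (fun z => f z / (z - p)) - contour c r (fun z => f z / (z - p)) = f p := by
  have hp : p ∈ U := hsub ⟨ball_subset_closedBall hpR, fun h => hpr (ball_subset_closedBall h)⟩
  have hrR : r ≤ R := by
    simp only [mem_ball, mem_closedBall, not_le] at hpR hpr
    linarith
  -- The divided difference of `f` at `p` is holomorphic across `p`, so its integrals over the two
  -- circles agree; only the `f p / (z - p)` part distinguishes them.
  have hd := (Complex.differentiableOn_dslope (hU.mem_nhds hp)).2 hf
  have hcont : ∀ s : ℝ, 0 < s → (s = R ∨ s = r) →
      contour c s (fun z => f z / (z - p)) =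
        contour c s (dslope f p) + f p * contour c s (fun z => (z - p)⁻¹) := by
    intro s hs hsr
    have hsp : ∀ z ∈ sphere c s, z - p ≠ 0 := by
      intro z hz h0
      rw [sub_eq_zero] at h0
      subst h0
      simp only [mem_ball, mem_closedBall, not_le, mem_sphere] at hpR hpr hz
      rcases hsr with rfl | rfl <;> linarith
    have hsU : sphere c s ⊆ U := by
      refine fun z hz => hsub ?_
      simp only [Set.mem_sdiff, mem_ball, mem_closedBall, not_lt, mem_sphere] at hz ⊢
      rcases hsr with rfl | rfl <;> constructor <;> linarith
    rw [← contour_const_mul, ← contour_add hs.le (hd.continuousOn.mono hsU)]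
    · refine contour_congr hs.le fun z hz => ?_
      have h1 := hsp z hz
      have h2 := sub_smul_dslope f p z
      simp only [smul_eq_mul] at h2
      rw [div_eq_iff h1, add_mul, mul_assoc, inv_mul_cancel₀ h1]
      linear_combination -h2
    · exact continuousOn_const.mul ((continuousOn_id.sub continuousOn_const).inv₀ hsp)
  have h0 : contour c r (fun z => (z - p)⁻¹) = 0 := by
    refine contour_eq_zero (U := {p}ᶜ) isOpen_compl_singleton ?_ hr.le ?_
    · exact (differentiableOn_id.sub_const p).inv fun z hz => sub_ne_zero.2 hz
    · exact fun z hz h => hpr (h ▸ hz)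
  rw [hcont R (hr.trans_le hrR) (Or.inl rfl), hcont r hr (Or.inr rfl), h0,
    contour_inv_sub hpR, contour_eq_of_annulus hU hd hr hrR hsub]
  ring

/-- The substitution `z ↦ 1 / z` on a circle around `0`. -/
lemma contour_comp_inv {ρ : ℝ} (hρ : 0 < ρ) (f : ℂ → ℂ) :
    contour 0 ρ f = contour 0 ρ⁻¹ (fun z => f z⁻¹ * (z ^ 2)⁻¹) := by
  unfold contour
  congr 1
  simp only [circleIntegral, deriv_circleMap, smul_eq_mul]
  -- Inversion reverses the orientation. The reflection θ ↦ 2π - θ undoes this and absorbs the minus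
  -- sign of d(1/z).
  have key : ∀ θ : ℝ, circleMap 0 ρ⁻¹ (2 * π - θ) = (circleMap 0 ρ θ)⁻¹ := by
    intro θ
    simp only [circleMap, zero_add, mul_inv, ← Complex.exp_neg, Complex.ofReal_inv]
    congr 1
    push_cast
    rw [sub_mul, Complex.exp_sub, Complex.exp_two_pi_mul_I, Complex.exp_neg, one_div]
  have hsub := intervalIntegral.integral_comp_sub_left (a := 0) (b := 2 * π) (fun θ : ℝ =>
    circleMap 0 ρ⁻¹ θ * I * (f (circleMap 0 ρ⁻¹ θ)⁻¹ * (circleMap 0 ρ⁻¹ θ ^ 2)⁻¹)) (2 * π)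
  simp only [sub_zero, sub_self] at hsub
  rw [← hsub]
  refine intervalIntegral.integral_congr fun θ _ => ?_
  have h0 : circleMap 0 ρ θ ≠ 0 := by
    have := circleMap_ne_center (c := 0) (R := ρ) (θ := θ) hρ.ne'
    simpa using this
  simp only [key, inv_inv]
  field_simp

/-- Fubini's theorem for two circles. -/
lemma contour_swap {c c' : ℂ} {r r' : ℝ} {F : ℂ → ℂ → ℂ} (hr : 0 ≤ r) (hr' : 0 ≤ r')
    (hF : ContinuousOn (fun q : ℂ × ℂ => F q.1 q.2) (sphere c r ×ˢ sphere c' r')) :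
    contour c r (fun z => contour c' r' (F z)) =
      contour c' r' (fun w => contour c r (fun z => F z w)) := by
  unfold contour
  simp only [circleIntegral, deriv_circleMap, smul_eq_mul]
  congr 1
  have hcont : Continuous fun q : ℝ × ℝ =>
      circleMap 0 r q.1 * I * (circleMap 0 r' q.2 * I * F (circleMap c r q.1) (circleMap c' r' q.2)) := by
    have : Continuous fun q : ℝ × ℝ => F (circleMap c r q.1) (circleMap c' r' q.2) :=
      hF.comp_continuous (f := fun q : ℝ × ℝ => (circleMap c r q.1, circleMap c' r' q.2))
        (by fun_prop)
        (fun q => ⟨circleMap_mem_sphere _ hr _, circleMap_mem_sphere _ hr' _⟩)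
    exact (((continuous_circleMap 0 r).comp continuous_fst).mul continuous_const).mul
      ((((continuous_circleMap 0 r').comp continuous_snd).mul continuous_const).mul this)
  have hswap := MeasureTheory.intervalIntegral_intervalIntegral_swap (a := 0) (b := 2 * π) (c := 0)
    (d := 2 * π) (F := fun θ θ' => circleMap 0 r θ * I *
      (circleMap 0 r' θ' * I * F (circleMap c r θ) (circleMap c' r' θ'))) ?_
  · simp only [intervalIntegral.integral_const_mul] at hswap ⊢
    simp_rw [mul_left_comm _ (2 * (π : ℂ) * I)⁻¹, intervalIntegral.integral_const_mul]
    rw [hswap]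
    congr 1
    refine intervalIntegral.integral_congr fun θ _ => ?_
    simp only [← intervalIntegral.integral_const_mul]
    refine intervalIntegral.integral_congr fun θ' _ => ?_
    ring
  · exact (hcont.continuousOn.integrableOn_compact (isCompact_uIcc.prod isCompact_uIcc)).mono_set
      (prod_mono uIoc_subset_uIcc uIoc_subset_uIcc)

/-- Termwise integration of a dominated series. -/
lemma hasSum_contour {ι : Type*} [Countable ι] {c : ℂ} {r : ℝ} {f : ι → ℂ → ℂ} {g : ℂ → ℂ}
    {u : ι → ℝ} (hr : 0 ≤ r) (hf : ∀ i, ContinuousOn (f i) (sphere c r))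
    (hu : Summable u) (hfu : ∀ i, ∀ z ∈ sphere c r, ‖f i z‖ ≤ u i)
    (hg : ∀ z ∈ sphere c r, HasSum (fun i => f i z) (g z)) :
    HasSum (fun i => contour c r (f i)) (contour c r g) := by
  unfold contour
  refine HasSum.mul_left _ ?_
  have hm : ∀ θ, circleMap c r θ ∈ sphere c r := fun θ => circleMap_mem_sphere _ hr _
  refine intervalIntegral.hasSum_integral_of_dominated_convergence (fun i _ => r * u i) ?_ ?_ ?_ ?_ ?_
  · intro i
    have : Continuous fun θ => f i (circleMap c r θ) :=
      (hf i).comp_continuous (continuous_circleMap c r) hm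
    refine Continuous.aestronglyMeasurable ?_
    simp only [deriv_circleMap, smul_eq_mul]
    exact ((continuous_circleMap 0 r).mul continuous_const).mul this
  · refine fun i => Eventually.of_forall fun θ _ => ?_
    simp only [deriv_circleMap, norm_smul, norm_mul, norm_circleMap_zero, Complex.norm_I, mul_one,
      abs_of_nonneg hr]
    exact mul_le_mul_of_nonneg_left (hfu i _ (hm θ)) hr
  · exact Eventually.of_forall fun θ _ => hu.mul_left r
  · exact intervalIntegrable_const
  · refine Eventually.of_forall fun θ _ => ?_
    simp only [smul_eq_mul]
    exact (hg _ (hm θ)).mul_left _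

/-! ### Laurent expansion in the punctured plane and pairing with moments around 1. -/

lemma ne_zero_of_mem_sphere_zero {r : ℝ} (hr : 0 < r) {z : ℂ} (hz : z ∈ sphere (0 : ℂ) r) :
    z ≠ 0 := by
  rintro rfl
  simp at hz
  exact hr.ne hz

lemma exists_bound_sphere {c : ℂ} {r : ℝ} {f : ℂ → ℂ} (hf : ContinuousOn f (sphere c r)) :
    ∃ M, 0 ≤ M ∧ ∀ z ∈ sphere c r, ‖f z‖ ≤ M := by
  obtain ⟨M, hM⟩ := (isCompact_sphere c r).exists_bound_of_continuousOn hf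
  exact ⟨max M 0, le_max_right _ _, fun z hz => (hM z hz).trans (le_max_left _ _)⟩

lemma sphere_one_subset {r : ℝ} (hr1 : r < 1) : sphere (1 : ℂ) r ⊆ {0}ᶜ := by
  rintro z hz rfl
  simp at hz
  exact hr1.ne hz.symm

lemma closedBall_diff_ball_zero_subset {r R : ℝ} (hr : 0 < r) :
    closedBall (0 : ℂ) R \ ball 0 r ⊆ {0}ᶜ := by
  rintro z hz rfl
  exact hz.2 (mem_ball_self hr)

lemma contour_zero_radius_eq {f : ℂ → ℂ} (hf : DifferentiableOn ℂ f {0}ᶜ) {r R : ℝ} (hr : 0 < r)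
    (hR : 0 < R) : contour 0 r f = contour 0 R f := by
  rcases le_total r R with h | h
  · exact (contour_eq_of_annulus isOpen_compl_singleton hf hr h
      (closedBall_diff_ball_zero_subset hr)).symm
  · exact contour_eq_of_annulus isOpen_compl_singleton hf hR h
      (closedBall_diff_ball_zero_subset hR)

lemma differentiableOn_zpow_mul {f : ℂ → ℂ} (hf : DifferentiableOn ℂ f {0}ᶜ) (m : ℤ) :
    DifferentiableOn ℂ (fun z => z ^ m * f z) {0}ᶜ :=
  (differentiableOn_zpow m _ (Or.inl (by simp))).mul hf

lemma hasSum_laurent_nonneg {f : ℂ → ℂ} {R : ℝ} {w : ℂ} (hR : 0 < R) (hwR : ‖w‖ < R)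
    (hf : ContinuousOn f (sphere 0 R)) :
    HasSum (fun n : ℕ => contour 0 R (fun z => z ^ (-(n : ℤ) - 1) * f z) * w ^ (n : ℤ))
      (contour 0 R (fun z => f z / (z - w))) := by
  simp_rw [← contour_mul_const]
  obtain ⟨M, hM0, hM⟩ := exists_bound_sphere hf
  refine hasSum_contour (u := fun n => (R⁻¹ * M) * (‖w‖ / R) ^ n) hR.le ?_ ?_ ?_ ?_
  · refine fun n => ((ContinuousOn.zpow₀ continuousOn_id _ ?_).mul hf).mul continuousOn_const
    exact fun z hz => Or.inl (ne_zero_of_mem_sphere_zero hR hz)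
  · exact (summable_geometric_of_lt_one (by positivity) ((div_lt_one hR).2 hwR)).mul_left _
  · intro n z hz
    have hz' : ‖z‖ = R := by simpa using hz
    rw [norm_mul, norm_mul, norm_zpow, norm_zpow, hz', zpow_sub_one₀ hR.ne', zpow_neg, zpow_natCast,
      zpow_natCast, div_pow]
    calc (R ^ n)⁻¹ * R⁻¹ * ‖f z‖ * ‖w‖ ^ n ≤ (R ^ n)⁻¹ * R⁻¹ * M * ‖w‖ ^ n := by
          gcongr; exact hM z hz
      _ = _ := by ring
  · intro z hz
    have hz' : ‖z‖ = R := by simpa using hz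
    have hz0 := ne_zero_of_mem_sphere_zero hR hz
    have hzw : z - w ≠ 0 := by
      intro h
      rw [sub_eq_zero] at h
      rw [← h, hz'] at hwR
      exact lt_irrefl _ hwR
    have h := (hasSum_geometric_of_norm_lt_one (ξ := w / z) (by
      rw [norm_div, hz']; exact (div_lt_one hR).2 hwR)).mul_left (z⁻¹ * f z)
    have e : z⁻¹ * f z * (1 - w / z)⁻¹ = f z / (z - w) := by
      have : 1 - w / z = (z - w) / z := by field_simp
      rw [this]
      field_simp
    rw [e] at h
    refine h.congr_fun ?_ |> fun h => h
    intro n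
    rw [zpow_sub_one₀ hz0, zpow_neg, zpow_natCast, zpow_natCast, div_pow]
    ring

lemma hasSum_laurent_neg {f : ℂ → ℂ} {R : ℝ} {w : ℂ} (hR : 0 < R) (hwR : R < ‖w‖)
    (hf : ContinuousOn f (sphere 0 R)) :
    HasSum (fun n : ℕ => contour 0 R (fun z => z ^ (-(-((n : ℤ) + 1)) - 1) * f z) *
      w ^ (-((n : ℤ) + 1))) (-contour 0 R (fun z => f z / (z - w))) := by
  simp_rw [← contour_mul_const, ← contour_neg]
  obtain ⟨M, hM0, hM⟩ := exists_bound_sphere hf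
  have hw : 0 < ‖w‖ := hR.trans hwR
  have hw0 : w ≠ 0 := norm_pos_iff.1 hw
  refine hasSum_contour (u := fun n => (‖w‖⁻¹ * M) * (R / ‖w‖) ^ n) hR.le ?_ ?_ ?_ ?_
  · refine fun n => ((ContinuousOn.zpow₀ continuousOn_id _ ?_).mul hf).mul continuousOn_const
    exact fun z hz => Or.inl (ne_zero_of_mem_sphere_zero hR hz)
  · exact (summable_geometric_of_lt_one (by positivity) ((div_lt_one hw).2 hwR)).mul_left _
  · intro n z hz
    have hz' : ‖z‖ = R := by simpa using hz
    rw [neg_neg, add_sub_cancel_right, norm_mul, norm_mul, norm_zpow, norm_zpow, hz', zpow_natCast,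
      zpow_neg, zpow_add_one₀ hw.ne', zpow_natCast, div_pow, mul_inv]
    calc R ^ n * ‖f z‖ * ((‖w‖ ^ n)⁻¹ * ‖w‖⁻¹) ≤ R ^ n * M * ((‖w‖ ^ n)⁻¹ * ‖w‖⁻¹) := by
          gcongr; exact hM z hz
      _ = _ := by ring
  · intro z hz
    have hz' : ‖z‖ = R := by simpa using hz
    have hzw : z - w ≠ 0 := by
      intro h
      rw [sub_eq_zero] at h
      rw [← h, hz'] at hwR
      exact lt_irrefl _ hwR
    have hzw' : w - z ≠ 0 := by rwa [← neg_sub, neg_ne_zero]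
    have h := (hasSum_geometric_of_norm_lt_one (ξ := z / w) (by
      rw [norm_div, hz']; exact (div_lt_one hw).2 hwR)).mul_left (w⁻¹ * f z)
    have e : w⁻¹ * f z * (1 - z / w)⁻¹ = -(f z / (z - w)) := by
      have : 1 - z / w = (w - z) / w := by field_simp
      rw [this, ← div_neg, neg_sub]
      field_simp
    rw [e] at h
    refine h.congr_fun ?_ |> fun h => h
    intro n
    rw [neg_neg, add_sub_cancel_right, zpow_neg, zpow_add_one₀ hw0, zpow_natCast, zpow_natCast,
      div_pow, mul_inv]
    ring

/-- Laurent expansion of a function that is holomorphic in the punctured plane. -/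
lemma hasSum_laurent {f : ℂ → ℂ} (hf : DifferentiableOn ℂ f {0}ᶜ) {R : ℝ} (hR : 0 < R) {w : ℂ}
    (hw : w ≠ 0) :
    HasSum (fun n : ℤ => contour 0 R (fun z => z ^ (-n - 1) * f z) * w ^ n) (f w) := by
  have hw' : 0 < ‖w‖ := norm_pos_iff.2 hw
  have hsub : ∀ {s : ℝ}, 0 < s → ContinuousOn f (sphere 0 s) := fun hs =>
    hf.continuousOn.mono fun z hz => ne_zero_of_mem_sphere_zero hs hz
  have h1 := hasSum_laurent_nonneg (R := 2 * ‖w‖) (w := w) (by positivity) (by linarith)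
    (hsub (by positivity))
  have h2 := hasSum_laurent_neg (R := ‖w‖ / 2) (w := w) (by positivity) (by linarith)
    (hsub (by positivity))
  have h3 := contour_sub_contour_div_sub (c := 0) (p := w) (r := ‖w‖ / 2) (R := 2 * ‖w‖)
    isOpen_compl_singleton hf (by positivity) (closedBall_diff_ball_zero_subset (by positivity))
    (by simp; linarith) (by simp [hw])
  -- The regular part comes from the circle of radius 2‖w‖ and the principal part from that of
  -- radius ‖w‖ / 2; all coefficients are then moved to the common radius `R`.
  have e : ∀ m : ℤ, ∀ s : ℝ, 0 < s → contour 0 s (fun z => z ^ m * f z) =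
      contour 0 R (fun z => z ^ m * f z) := fun m s hs =>
    contour_zero_radius_eq (differentiableOn_zpow_mul hf m) hs hR
  simp_rw [e _ _ (show 0 < 2 * ‖w‖ by positivity)] at h1
  simp_rw [e _ _ (show 0 < ‖w‖ / 2 by positivity)] at h2
  rw [← h3, sub_eq_add_neg]
  exact HasSum.of_nat_of_neg_add_one
    (f := fun n : ℤ => contour 0 R (fun z => z ^ (-n - 1) * f z) * w ^ n) h1 h2

lemma zpow_le_zpow_add_zpow {s t u : ℝ} (hs : 0 < s) (hsu : s ≤ u) (hut : u ≤ t) (n : ℤ) :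
    u ^ n ≤ s ^ n + t ^ n := by
  have hu : 0 < u := hs.trans_le hsu
  have ht : 0 < t := hu.trans_le hut
  obtain ⟨k, rfl | rfl⟩ := n.eq_nat_or_neg
  · simp only [zpow_natCast]
    have := pow_le_pow_left₀ hu.le hut k
    have := pow_nonneg hs.le k
    linarith
  · simp only [zpow_neg, zpow_natCast]
    have h1 : (u ^ k)⁻¹ ≤ (s ^ k)⁻¹ :=
      inv_anti₀ (pow_pos hs k) (pow_le_pow_left₀ hs.le hsu k)
    have := inv_nonneg.2 (pow_nonneg ht.le k)
    linarith

lemma norm_mem_of_mem_sphere_one {r : ℝ} {w : ℂ} (hw : w ∈ sphere (1 : ℂ) r) :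
    1 - r ≤ ‖w‖ ∧ ‖w‖ ≤ 1 + r := by
  have h : ‖w - 1‖ = r := by simpa [dist_eq_norm] using hw
  constructor
  · have := norm_sub_norm_le (1 : ℂ) w
    rw [norm_one, norm_sub_rev, h] at this
    linarith
  · have := norm_add_le (w - 1) 1
    rw [sub_add_cancel, norm_one, h] at this
    linarith

/-- The pairing of the Laurent coefficients of `f` with the moments `∮ w ^ n h(w)`. -/
lemma hasSum_laurent_pairing {f h : ℂ → ℂ} (hf : DifferentiableOn ℂ f {0}ᶜ) {R r : ℝ}
    (hR : 0 < R) (hr : 0 < r) (hr1 : r < 1) (hh : ContinuousOn h (sphere 1 r)) :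
    HasSum (fun n : ℤ => contour 0 R (fun z => z ^ (-n - 1) * f z) *
      contour 1 r (fun w => w ^ n * h w)) (contour 1 r (fun w => f w * h w)) := by
  obtain ⟨M, hM0, hM⟩ := exists_bound_sphere hh
  simp_rw [← contour_const_mul]
  -- Absolute convergence at the real points 1 - r and 1 + r dominates the series on the whole
  -- circle, because ‖w‖ lies between them.
  have hs : ∀ s : ℝ, 0 < s →
      Summable fun n : ℤ => ‖contour 0 R (fun z => z ^ (-n - 1) * f z)‖ * s ^ n := by
    intro s hs
    have := (hasSum_laurent hf hR (w := (s : ℂ)) (by exact_mod_cast hs.ne')).summable.norm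
    simpa [norm_mul, abs_of_pos hs] using this
  refine hasSum_contour (u := fun n : ℤ => (‖contour 0 R (fun z => z ^ (-n - 1) * f z)‖ * (1 - r) ^ n +
    ‖contour 0 R (fun z => z ^ (-n - 1) * f z)‖ * (1 + r) ^ n) * M) hr.le ?_ ?_ ?_ ?_
  · refine fun n => continuousOn_const.mul ((ContinuousOn.zpow₀ continuousOn_id _ ?_).mul hh)
    exact fun z hz => Or.inl (sphere_one_subset hr1 hz)
  · exact ((hs _ (by linarith)).add (hs _ (by linarith))).mul_right _
  · intro n w hw
    obtain ⟨h1, h2⟩ := norm_mem_of_mem_sphere_one hw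
    rw [norm_mul, norm_mul, norm_zpow, ← mul_add, mul_assoc]
    have := zpow_le_zpow_add_zpow (by linarith) h1 h2 n
    have := hM w hw
    gcongr
  · intro w hw
    have := (hasSum_laurent hf hR (sphere_one_subset hr1 hw)).mul_right (h w)
    simpa only [mul_assoc] using this

/-! ### The dual functions and biorthogonality. -/

/-- The residue of `v ^ (m - 1) dv` at `w = 1`, for `v = w (w - 1)`. -/
lemma contour_zpow_mul_deriv {r : ℝ} (hr : 0 < r) (hr1 : r < 1) (m : ℤ) :
    contour 1 r (fun w => (w * (w - 1)) ^ (m - 1) * (2 * w - 1)) = if m = 0 then 1 else 0 := by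
  have hne : ∀ w ∈ sphere (1 : ℂ) r, w ≠ 0 ∧ w - 1 ≠ 0 := by
    intro w hw
    refine ⟨sphere_one_subset hr1 hw, fun h => ?_⟩
    rw [sub_eq_zero] at h
    rw [h] at hw
    simp at hw
    exact hr.ne hw
  split_ifs with hm
  · subst hm
    have h := contour_div_sub (c := 1) (p := 1) (r := r) (f := fun w : ℂ => (2 * w - 1) / w)
      (U := {0}ᶜ) ?_ ?_ (mem_ball_self hr)
    · norm_num at h
      refine Eq.trans ?_ h
      refine contour_congr hr.le fun w hw => ?_
      have := hne w hw
      rw [zero_sub, zpow_neg_one]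
      field_simp [this.1, this.2]
    · exact fun w hw => (by fun_prop (disch := exact hw) : DifferentiableAt ℂ (fun w : ℂ => (2 * w - 1) / w) w).differentiableWithinAt
    · rintro z hz rfl
      simp at hz
      linarith
  · unfold contour
    -- For m ≠ 0 the integrand has the single-valued primitive v^m / m.
    rw [circleIntegral.integral_eq_zero_of_hasDerivWithinAt (f := fun w => (w * (w - 1)) ^ m / m)
      hr.le, mul_zero]
    intro w hw
    have h0 := hne w hw
    have hd : HasDerivAt (fun w : ℂ => w * (w - 1)) (2 * w - 1) w := by
      have := (hasDerivAt_id w).mul ((hasDerivAt_id w).sub_const 1)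
      simp only [id] at this
      convert! this using 1
      ring
    have := ((hasDerivAt_zpow m _ (Or.inl (mul_ne_zero h0.1 h0.2))).comp w hd).div_const (m : ℂ)
    have hm' : (m : ℂ) ≠ 0 := by exact_mod_cast hm
    refine HasDerivAt.hasDerivWithinAt ?_
    convert! this using 1
    field_simp

/-- The function `e ^ (α z + β / z)`. -/
noncomputable def expFactor (α β z : ℂ) : ℂ := exp (α * z + β / z)

lemma expFactor_ne_zero (α β z : ℂ) : expFactor α β z ≠ 0 := exp_ne_zero _

lemma differentiableOn_expFactor (α β : ℂ) : DifferentiableOn ℂ (expFactor α β) {0}ᶜ := by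
  intro z hz
  refine DifferentiableAt.differentiableWithinAt ?_
  unfold expFactor
  fun_prop (disch := exact hz)

/-- The function `Φ^{n,t}_j`, written with the variable `w = 1 / z`. -/
noncomputable def dualFun (α β : ℂ) (r : ℝ) (n : ℤ) (j : ℕ) (x : ℤ) : ℂ :=
  contour 1 r fun w => w ^ (x + 2 * n) / expFactor α β w *
    ((2 * w - 1) * ((w * (w - 1)) ^ (j + 1))⁻¹)

/-- The substitution z ↦ 1/z. For l ≤ n the integrand is z^(-(x+2n)-1) (z (z - 1))^(n-l) G_t(z), so
this is a Laurent coefficient of index x + 2n. -/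
lemma psi_eq (a b : ℝ → ℝ) {ρ : ℝ} (hρ : 0 < ρ) (hρ1 : ρ < 1) {n l : ℤ} (hn : 0 ≤ n) (hl : 0 ≤ l)
    (t : ℝ) (x : ℤ) :
    psi (fun _ => 1) (fun i => -2 * i) a b ρ n t l x =
      contour 0 ρ⁻¹ fun z => z ^ (-x - l - n - 1) * (z - 1) ^ (n - l) *
        expFactor (a t) (b t) z := by
  unfold psi
  rw [contour_comp_inv hρ]
  refine contour_congr (inv_pos.2 hρ).le fun z hz => ?_
  have hz0 := ne_zero_of_mem_sphere_zero (inv_pos.2 hρ) hz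
  have hz' : ‖z‖ = ρ⁻¹ := by simpa using hz
  have hz1 : z - 1 ≠ 0 := by
    intro h
    rw [sub_eq_zero] at h
    rw [h, norm_one, eq_comm, inv_eq_one] at hz'
    exact hρ1.ne hz'
  lift n to ℕ using hn
  lift l to ℕ using hl
  have e1 : (1 : ℂ) - z⁻¹ = (z - 1) * z⁻¹ := by field_simp
  have e2 : (a t : ℂ) / z⁻¹ + b t * z⁻¹ = a t * z + b t / z := by
    rw [div_inv_eq_mul, div_eq_mul_inv]
  simp only [ofReal_one, one_mul, Finset.prod_const, Int.card_Icc, add_sub_cancel_right,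
    Int.toNat_natCast, e1, e2, expFactor]
  have e3 : ((z - 1) * z⁻¹) ^ n / ((z - 1) * z⁻¹) ^ l =
      (z - 1) ^ ((n : ℤ) - l) * z ^ ((l : ℤ) - n) := by
    rw [zpow_sub₀ hz1, zpow_sub₀ hz0]
    simp only [zpow_natCast, mul_pow, inv_pow]
    field_simp
  have e4 : z⁻¹ ^ (x - -2 * (l : ℤ) - 1) * (z ^ 2)⁻¹ * z ^ ((l : ℤ) - n) =
      z ^ (-x - l - n - 1) := by
    rw [inv_zpow', ← zpow_natCast, ← zpow_neg, ← zpow_add₀ hz0, ← zpow_add₀ hz0]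
    congr 1
    push_cast
    ring
  rw [e3, ← e4]
  ring

/-- Summing over x replaces the Laurent coefficients by the function (w (w - 1))^(n-l) G_t itself.
The factor G_t cancels, leaving the residue of v^(k-l-1) dv. -/
lemma hasSum_psi_mul_dualFun (a b : ℝ → ℝ) {ρ r : ℝ} (hρ : 0 < ρ) (hρ1 : ρ < 1) (hr : 0 < r)
    (hr1 : r < 1) {n : ℤ} (t : ℝ) {k l : ℤ} (hk : k ∈ Finset.Icc 1 n) (hl : l ∈ Finset.Icc 1 n) :
    HasSum (fun x : ℤ => psi (fun _ => 1) (fun i => -2 * i) a b ρ n t l x *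
      dualFun (a t) (b t) r n (n - k).toNat x) (if k = l then 1 else 0) := by
  rw [Finset.mem_Icc] at hk hl
  obtain ⟨i, hi⟩ := Int.eq_ofNat_of_zero_le (sub_nonneg.2 hk.2)
  obtain ⟨j, hj⟩ := Int.eq_ofNat_of_zero_le (sub_nonneg.2 hl.2)
  have hne : ∀ w ∈ sphere (1 : ℂ) r, w ≠ 0 ∧ w - 1 ≠ 0 := by
    intro w hw
    refine ⟨sphere_one_subset hr1 hw, fun h => ?_⟩
    rw [sub_eq_zero] at h
    rw [h] at hw
    simp at hw
    exact hr.ne hw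
  have hG := differentiableOn_expFactor (a t) (b t)
  have hf : DifferentiableOn ℂ (fun z => (z * (z - 1)) ^ j * expFactor (a t) (b t) z) {0}ᶜ := by
    refine DifferentiableOn.mul ?_ hG
    fun_prop
  have hh : ContinuousOn (fun w => (expFactor (a t) (b t) w)⁻¹ *
      ((2 * w - 1) * ((w * (w - 1)) ^ (i + 1))⁻¹)) (sphere 1 r) := by
    refine ((hG.continuousOn.mono (sphere_one_subset hr1)).inv₀
      fun _ _ => expFactor_ne_zero _ _ _).mul (ContinuousOn.mul (by fun_prop) ?_)
    refine ContinuousOn.inv₀ (by fun_prop) fun w hw => ?_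
    exact pow_ne_zero _ (mul_ne_zero (hne w hw).1 (hne w hw).2)
  have h := hasSum_laurent_pairing hf (inv_pos.2 hρ) hr hr1 hh
  have e : contour 1 r (fun w => (w * (w - 1)) ^ j * expFactor (a t) (b t) w *
      ((expFactor (a t) (b t) w)⁻¹ * ((2 * w - 1) * ((w * (w - 1)) ^ (i + 1))⁻¹))) =
      if k = l then 1 else 0 := by
    have := contour_zpow_mul_deriv hr hr1 (k - l)
    simp only [sub_eq_zero] at this
    rw [← this]
    refine contour_congr hr.le fun w hw => ?_
    have h1 := expFactor_ne_zero (a t) (b t) w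
    have hv := mul_ne_zero (hne w hw).1 (hne w hw).2
    have e5 : (w * (w - 1)) ^ (k - l - 1) = (w * (w - 1)) ^ j * ((w * (w - 1)) ^ (i + 1))⁻¹ := by
      rw [← zpow_natCast, ← zpow_natCast, ← zpow_neg, ← zpow_add₀ hv]
      congr 1
      push_cast
      omega
    rw [e5]
    field_simp
  rw [e] at h
  -- The Laurent index is x + 2n; the shift is a bijection of ℤ.
  have h' := (Equiv.addRight (2 * n)).hasSum_iff.2 h
  refine h'.congr_fun ?_ |> fun h => h
  intro x
  simp only [Function.comp, Equiv.coe_addRight]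
  rw [psi_eq a b hρ hρ1 (by omega) (by omega)]
  congr 1
  · refine contour_congr (inv_pos.2 hρ).le fun z hz => ?_
    have hz0 := ne_zero_of_mem_sphere_zero (inv_pos.2 hρ) hz
    rw [hj, mul_pow, ← mul_assoc, ← mul_assoc, zpow_natCast, ← zpow_natCast z j,
      ← zpow_add₀ hz0]
    congr 3
    omega
  · unfold dualFun
    refine contour_congr hr.le fun w hw => ?_
    rw [hi, div_eq_mul_inv, mul_assoc]
    rfl

/-! ### Polynomiality of the dual functions in x. -/

/-- The space of polynomial functions on `ℤ` of degree less than `m`. -/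
def polySpan (m : ℕ) : Submodule ℂ (ℤ → ℂ) :=
  Submodule.span ℂ (range fun (l : Fin m) (x : ℤ) => (x : ℂ) ^ (l : ℕ))

lemma spaceV_one (n : ℤ) : spaceV (fun _ => 1) n = polySpan n.toNat := by
  unfold spaceV polySpan
  congr 1
  ext f
  simp only [Finset.filter_true, Int.card_Icc, add_sub_cancel_right, ofReal_one, one_zpow, mul_one,
    mem_ofPred_eq, mem_range]
  constructor
  · rintro ⟨j, hj, l, hl, rfl⟩
    exact ⟨⟨l, hl⟩, rfl⟩
  · rintro ⟨l, rfl⟩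
    refine ⟨1, ?_, l, l.2, rfl⟩
    have := l.2
    rw [Finset.mem_Icc]
    omega

lemma polySpan_mono {m k : ℕ} (h : m ≤ k) : polySpan m ≤ polySpan k := by
  refine Submodule.span_mono ?_
  rintro _ ⟨l, rfl⟩
  exact ⟨⟨l, l.2.trans_le h⟩, rfl⟩

lemma eval_mem_polySpan {P : Polynomial ℂ} {m : ℕ} (h : P.natDegree < m) :
    (fun x : ℤ => P.eval (x : ℂ)) ∈ polySpan m := by
  have : (fun x : ℤ => P.eval (x : ℂ)) =
      ∑ i ∈ Finset.range (P.natDegree + 1), P.coeff i • fun x : ℤ => (x : ℂ) ^ i := by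
    ext x
    simp [Polynomial.eval_eq_sum_range]
  rw [this]
  refine Submodule.sum_mem _ fun i hi => Submodule.smul_mem _ _ (Submodule.subset_span ?_)
  rw [Finset.mem_range] at hi
  exact ⟨⟨i, by omega⟩, rfl⟩

lemma closedBall_one_subset {r : ℝ} (hr1 : r < 1) : closedBall (1 : ℂ) r ⊆ {0}ᶜ := by
  rintro z hz rfl
  simp at hz
  linarith

lemma contour_zpow_div_pow {r : ℝ} (hr : 0 < r) (hr1 : r < 1) (m : ℕ) (x : ℤ) :
    contour 1 r (fun w => w ^ x * ((w - 1) ^ (m + 1))⁻¹) =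
      (∏ i ∈ Finset.range m, ((x : ℂ) - i)) / m.factorial := by
  have hd : DifferentiableOn ℂ (fun w : ℂ => w ^ x) (closedBall 1 r) :=
    differentiableOn_zpow x _ (Or.inl fun h => closedBall_one_subset hr1 h rfl)
  have h := hd.circleIntegral_one_div_sub_center_pow_smul hr m
  unfold contour
  simp only [smul_eq_mul, one_div] at h
  simp_rw [mul_comm _ ((_ : ℂ) ^ (m + 1))⁻¹, h, iteratedDeriv_eq_iterate, iter_deriv_zpow, one_zpow,
    mul_one]
  rw [div_mul_eq_mul_div, mul_div_assoc, ← mul_assoc, inv_mul_cancel₀ two_pi_I_ne_zero, one_mul]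

/-- Induction on the order of the pole at 1. Writing h(w) = h(1) + (w - 1) `dslope h 1 w` lowers the
order by one, up to a multiple of the binomial polynomial computed in `contour_zpow_div_pow`. -/
lemma contour_zpow_mul_mem_polySpan {r : ℝ} (hr : 0 < r) (hr1 : r < 1) (m : ℕ) {h : ℂ → ℂ}
    (hh : DifferentiableOn ℂ h {0}ᶜ) :
    (fun x : ℤ => contour 1 r fun w => w ^ x * (h w * ((w - 1) ^ m)⁻¹)) ∈ polySpan m := by
  induction m generalizing h with
  | zero =>
    have : (fun x : ℤ => contour 1 r fun w => w ^ x * (h w * ((w - 1) ^ 0)⁻¹)) = 0 := by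
      ext x
      simp only [pow_zero, inv_one, mul_one, Pi.zero_apply]
      exact contour_eq_zero isOpen_compl_singleton (differentiableOn_zpow_mul hh x) hr.le
        (closedBall_one_subset hr1)
    rw [this]
    exact zero_mem _
  | succ m ih =>
    have hd := (Complex.differentiableOn_dslope (c := 1) (isOpen_compl_singleton.mem_nhds
      (by simp : (1 : ℂ) ∈ ({0}ᶜ : Set ℂ)))).2 hh
    have hne : ∀ w ∈ sphere (1 : ℂ) r, w - 1 ≠ 0 := by
      intro w hw h
      rw [sub_eq_zero] at h
      rw [h] at hw
      simp at hw
      exact hr.ne hw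
    have key : (fun x : ℤ => contour 1 r fun w => w ^ x * (h w * ((w - 1) ^ (m + 1))⁻¹)) =
        (fun x : ℤ => contour 1 r fun w => w ^ x * (dslope h 1 w * ((w - 1) ^ m)⁻¹)) +
        h 1 • fun x : ℤ => contour 1 r fun w => w ^ x * ((w - 1) ^ (m + 1))⁻¹ := by
      ext x
      simp only [Pi.add_apply, Pi.smul_apply, smul_eq_mul]
      have hz : ContinuousOn (fun w : ℂ => w ^ x) (sphere 1 r) :=
        continuousOn_id.zpow₀ _ fun w hw => Or.inl (sphere_one_subset hr1 hw)
      have hi : ∀ k : ℕ, ContinuousOn (fun w : ℂ => ((w - 1) ^ k)⁻¹) (sphere 1 r) := fun k =>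
        ContinuousOn.inv₀ (by fun_prop) fun w hw => pow_ne_zero _ (hne w hw)
      rw [← contour_const_mul, ← contour_add hr.le
        (f := fun w => w ^ x * (dslope h 1 w * ((w - 1) ^ m)⁻¹))
        (g := fun w => h 1 * (w ^ x * ((w - 1) ^ (m + 1))⁻¹)) (hz.mul ((hd.continuousOn.mono
        (sphere_one_subset hr1)).mul (hi m))) (continuousOn_const.mul (hz.mul (hi _)))]
      refine contour_congr hr.le fun w hw => ?_
      have h1 := hne w hw
      have h2 := sub_smul_dslope h 1 w
      simp only [smul_eq_mul] at h2
      rw [pow_succ]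
      field_simp
      linear_combination -w ^ x * h2
    rw [key]
    refine Submodule.add_mem _ (polySpan_mono (Nat.le_succ m) (ih hd)) (Submodule.smul_mem _ _ ?_)
    simp_rw [contour_zpow_div_pow hr hr1]
    have := eval_mem_polySpan (m := m + 1) (P := Polynomial.C (m.factorial : ℂ)⁻¹ *
      ∏ i ∈ Finset.range m, (Polynomial.X - Polynomial.C (i : ℂ))) ?_
    · simpa [Polynomial.eval_prod, div_eq_inv_mul] using this
    · refine Nat.lt_succ_of_le ((Polynomial.natDegree_C_mul_le _ _).trans ?_)
      rw [Polynomial.natDegree_finsetProd_X_sub_C_eq_card]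
      simp

lemma dualFun_mem_polySpan (α β : ℂ) {r : ℝ} (hr : 0 < r) (hr1 : r < 1) (n : ℤ) (j : ℕ) :
    dualFun α β r n j ∈ polySpan (j + 1) := by
  have hG := differentiableOn_expFactor α β
  have hd : DifferentiableOn ℂ (fun w => w ^ (2 * n) * ((expFactor α β w)⁻¹ *
      ((2 * w - 1) * (w ^ (j + 1))⁻¹))) {0}ᶜ := by
    refine differentiableOn_zpow_mul ((hG.inv fun _ _ => expFactor_ne_zero _ _ _).mul
      (DifferentiableOn.mul (by fun_prop) (DifferentiableOn.inv (by fun_prop) fun z hz => ?_))) _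
    exact pow_ne_zero _ hz
  convert! contour_zpow_mul_mem_polySpan hr hr1 (j + 1) hd using 1
  ext x
  unfold dualFun
  refine contour_congr hr.le fun w hw => ?_
  rw [zpow_add₀ (sphere_one_subset hr1 hw), mul_pow, mul_inv, div_eq_mul_inv]
  ring

/-! ### Existence and uniqueness of the dual family. -/

lemma IsDualFamily.hasSum_pairing {v : ℤ → ℝ} {y : ℤ → ℤ} {a b : ℝ → ℝ} {ρ : ℝ} {n : ℤ} {t : ℝ}
    {F : Finset.Icc (1 : ℤ) n → ℤ → ℂ}
    (hF : ∀ k l : Finset.Icc (1 : ℤ) n,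
      HasSum (fun x : ℤ => psi v y a b ρ n t l x * F k x) (if k = l then 1 else 0))
    (c : Finset.Icc (1 : ℤ) n → ℂ) (l : Finset.Icc (1 : ℤ) n) :
    HasSum (fun x : ℤ => psi v y a b ρ n t l x * (∑ k, c k • F k) x) (c l) := by
  have h : HasSum (fun x : ℤ => ∑ k, c k * (psi v y a b ρ n t l x * F k x))
      (∑ k, c k * if k = l then 1 else 0) := by
    refine hasSum_sum fun k _ => ?_
    exact (hF k l).mul_left (c k)
  simp only [mul_ite, mul_one, mul_zero, Finset.sum_ite_eq', Finset.mem_univ, if_true] at h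
  refine h.congr_fun ?_ |> fun h => h
  intro x
  simp only [Finset.sum_apply, Pi.smul_apply, smul_eq_mul, Finset.mul_sum]
  exact Finset.sum_congr rfl fun k _ => by ring

/-- Both families span V_n, so F' k - F k is a combination of the F's. Its pairings with all Ψ
vanish, and these pairings are its coefficients. -/
lemma IsDualFamily.unique {v : ℤ → ℝ} {y : ℤ → ℤ} {a b : ℝ → ℝ} {ρ : ℝ} {n : ℤ} {t : ℝ}
    {F F' : Finset.Icc (1 : ℤ) n → ℤ → ℂ} (hF : IsDualFamily v y a b ρ n t F)
    (hF' : IsDualFamily v y a b ρ n t F') : F' = F := by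
  ext1 k
  have hmem : F' k - F k ∈ Submodule.span ℂ (range F) := by
    refine Submodule.sub_mem _ ?_ (Submodule.subset_span ⟨k, rfl⟩)
    rw [hF.2, ← hF'.2]
    exact Submodule.subset_span ⟨k, rfl⟩
  obtain ⟨c, hc⟩ := (Submodule.mem_span_range_iff_exists_fun ℂ).1 hmem
  have hc0 : ∀ l, c l = 0 := by
    intro l
    have h1 := IsDualFamily.hasSum_pairing hF.1 c l
    have h2 := (hF'.1 k l).sub (hF.1 k l)
    rw [hc, ] at h1
    simp only [sub_self, Pi.sub_apply, mul_sub] at h1 h2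
    exact h1.unique h2
  simp only [hc0, zero_smul, Finset.sum_const_zero] at hc
  exact sub_eq_zero.1 hc.symm

lemma isDualFamily_dualFun (a b : ℝ → ℝ) {ρ r : ℝ} (hρ : 0 < ρ) (hρ1 : ρ < 1) (hr : 0 < r)
    (hr1 : r < 1) (n : ℤ) (t : ℝ) :
    IsDualFamily (fun _ => 1) (fun i => -2 * i) a b ρ n t
      fun k => dualFun (a t) (b t) r n (n - k).toNat := by
  have hpair : ∀ k l : Finset.Icc (1 : ℤ) n,
      HasSum (fun x : ℤ => psi (fun _ => 1) (fun i => -2 * i) a b ρ n t l x *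
        dualFun (a t) (b t) r n (n - k).toNat x) (if k = l then 1 else 0) := by
    intro k l
    simpa only [Subtype.ext_iff] using
      hasSum_psi_mul_dualFun a b hρ hρ1 hr hr1 t k.2 l.2
  refine ⟨hpair, ?_⟩
  rw [spaceV_one]
  have hfin : FiniteDimensional ℂ (polySpan n.toNat) :=
    FiniteDimensional.span_of_finite ℂ (finite_range _)
  refine Submodule.eq_of_le_of_finrank_le ?_ ?_
  · rw [Submodule.span_le]
    rintro _ ⟨k, rfl⟩
    have hk := Finset.mem_Icc.1 k.2
    exact polySpan_mono (by omega) (dualFun_mem_polySpan (a t) (b t) hr hr1 n (n - k).toNat)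
  -- The span has full dimension because pairing a linear relation with Ψ annihilates each
  -- coefficient.
  · rw [finrank_span_eq_card]
    · refine (finrank_range_le_card _).trans ?_
      simp
    · rw [Fintype.linearIndependent_iff]
      intro c hc l
      have h := IsDualFamily.hasSum_pairing hpair c l
      rw [hc] at h
      simp only [Pi.zero_apply, mul_zero] at h
      exact h.unique hasSum_zero

/-- By uniqueness this is valid for every radius in (0, 1), so `r` may be chosen later to suit the
estimates. -/
lemma phi_eq_dualFun (a b : ℝ → ℝ) {ρ r : ℝ} (hρ : 0 < ρ) (hρ1 : ρ < 1) (hr : 0 < r)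
    (hr1 : r < 1) (n : ℤ) (t : ℝ) (k : Finset.Icc (1 : ℤ) n) :
    phi (fun _ => 1) (fun i => -2 * i) a b ρ n t k =
      dualFun (a t) (b t) r n (n - k).toNat := by
  have h := isDualFamily_dualFun a b hρ hρ1 hr hr1 n t
  exact congrFun (h.unique (Classical.epsilon_spec ⟨_, h⟩)) k

lemma existsUnique_isDualFamily (a b : ℝ → ℝ) {ρ : ℝ} (hρ : 0 < ρ) (hρ1 : ρ < 1) (n : ℤ) (t : ℝ) :
    ∃! F, IsDualFamily (fun _ => 1) (fun i => -2 * i) a b ρ n t F :=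
  have h := isDualFamily_dualFun a b hρ hρ1 hρ hρ1 n t
  ⟨_, h, fun _ h' => h.unique h'⟩

/-! ### Sums of products of contour integrals, by residues. -/

lemma circleIntegrable_contour {c c' : ℂ} {r r' : ℝ} {F : ℂ → ℂ → ℂ} (hr : 0 ≤ r) (hr' : 0 ≤ r')
    (hF : ContinuousOn (fun q : ℂ × ℂ => F q.1 q.2) (sphere c r ×ˢ sphere c' r')) :
    CircleIntegrable (fun w => contour c r (fun z => F z w)) c' r' := by
  refine Continuous.intervalIntegrable ?_ _ _
  unfold contour
  refine continuous_const.mul ?_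
  unfold circleIntegral
  refine intervalIntegral.continuous_parametric_intervalIntegral_of_continuous' ?_ _ _
  simp only [deriv_circleMap, smul_eq_mul]
  have : Continuous fun q : ℝ × ℝ => F (circleMap c r q.2) (circleMap c' r' q.1) :=
    hF.comp_continuous (f := fun q : ℝ × ℝ => (circleMap c r q.2, circleMap c' r' q.1))
      (((continuous_circleMap c r).comp continuous_snd).prodMk
        ((continuous_circleMap c' r').comp continuous_fst))
      (fun q => ⟨circleMap_mem_sphere _ hr _, circleMap_mem_sphere _ hr' _⟩)
  exact (((continuous_circleMap 0 r).comp continuous_snd).mul continuous_const).mul this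

lemma contour_sub_of_circleIntegrable {c : ℂ} {r : ℝ} {f g : ℂ → ℂ}
    (hf : CircleIntegrable f c r) (hg : CircleIntegrable g c r) :
    contour c r (fun z => f z - g z) = contour c r f - contour c r g := by
  unfold contour
  rw [← mul_sub, ← circleIntegral.integral_sub hf hg]

lemma ne_of_mem_sphere_one {r : ℝ} (hr : 0 < r) {w : ℂ} (hw : w ∈ sphere (1 : ℂ) r) :
    w - 1 ≠ 0 := by
  intro h
  rw [sub_eq_zero] at h
  rw [h] at hw
  simp at hw
  exact hr.ne hw

lemma two_mul_sub_one_ne_zero {r : ℝ} (hr : r < 1 / 2) {w : ℂ} (hw : w ∈ sphere (1 : ℂ) r) :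
    2 * w - 1 ≠ 0 := by
  intro h
  have h1 : w - 1 = -1 / 2 := by linear_combination h / 2
  have h2 : ‖w - 1‖ = r := by simpa [dist_eq_norm] using hw
  rw [h1] at h2
  norm_num at h2
  linarith

lemma norm_sub_one_of_mem {r : ℝ} {w : ℂ} (hw : w ∈ sphere (1 : ℂ) r) : ‖w - 1‖ = r := by
  simpa [dist_eq_norm] using hw

/-- Applied with v = z (z - 1) and V = w (w - 1), when V - v = (w - z)(w + z - 1). -/
lemma geom_sum_ratio {v V : ℂ} (hV : V ≠ 0) (hne : V - v ≠ 0) (D : ℕ) :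
    ∑ j ∈ Finset.range D, v ^ j * (V ^ (j + 1))⁻¹ =
      1 / (V - v) - v ^ D * (V ^ D)⁻¹ / (V - v) := by
  induction D with
  | zero => simp
  | succ D ih =>
    rw [Finset.sum_range_succ, ih]
    field_simp
    ring

lemma continuousOn_kernel {A B : ℂ → ℂ} {s t : Set ℂ} (hA : ContinuousOn A s)
    (hB : ContinuousOn B t) (hd : ∀ z ∈ s, ∀ w ∈ t, (w - z) * (w + z - 1) ≠ 0) :
    ContinuousOn (fun q : ℂ × ℂ => A q.1 * (B q.2 / ((q.2 - q.1) * (q.2 + q.1 - 1)))) (s ×ˢ t) := by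
  have h1 : ContinuousOn (fun q : ℂ × ℂ => A q.1) (s ×ˢ t) :=
    hA.comp continuousOn_fst fun q hq => hq.1
  have h2 : ContinuousOn (fun q : ℂ × ℂ => B q.2) (s ×ˢ t) :=
    hB.comp continuousOn_snd fun q hq => hq.2
  exact h1.mul (h2.div (by fun_prop) fun q hq => hd q.1 hq.1 q.2 hq.2)

/-- The poles of `1 / ((w - z) (w + z - 1))` in `w` lie outside the circle around `1`. -/
lemma contour_kernel_eq_zero {b : ℂ → ℂ} (hb : DifferentiableOn ℂ b {0}ᶜ) {r : ℝ} (hr : 0 ≤ r)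
    (hr1 : r < 1) {z : ℂ} (hz1 : r < ‖z - 1‖) (hz0 : r < ‖z‖) :
    contour 1 r (fun w => b w * (2 * w - 1) / ((w - z) * (w + z - 1))) = 0 := by
  have hU : IsOpen ({0}ᶜ ∩ ({z}ᶜ ∩ {1 - z}ᶜ) : Set ℂ) :=
    isOpen_compl_singleton.inter (isOpen_compl_singleton.inter isOpen_compl_singleton)
  refine contour_eq_zero hU ?_ hr ?_
  · refine ((hb.mono inter_subset_left).mul (by fun_prop)).div (by fun_prop) ?_
    rintro w ⟨-, h1, h2⟩
    refine mul_ne_zero (sub_ne_zero.2 h1) fun h => h2 ?_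
    rw [mem_singleton_iff]
    linear_combination h
  · intro w hw
    have hw' : ‖w - 1‖ ≤ r := by simpa [dist_eq_norm] using hw
    refine ⟨closedBall_one_subset hr1 hw, ?_, ?_⟩
    · rintro rfl
      linarith
    · intro h
      rw [mem_singleton_iff] at h
      rw [h, sub_sub_cancel_left, norm_neg] at hw'
      linarith

/-- A finite sum of products of contour integrals around `1`, evaluated by residues. -/
lemma sum_contour_mul_contour {a b : ℂ → ℂ} (ha : DifferentiableOn ℂ a {0}ᶜ)
    (hb : DifferentiableOn ℂ b {0}ᶜ) {r r' : ℝ} (hr : 0 < r) (hrr : r < r') (hrr1 : r + r' < 1)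
    {e : ℤ} {D : ℕ} (hD : 0 ≤ e + D) :
    ∑ j ∈ Finset.range D, contour 1 r' (fun z => a z * (z - 1) ^ e * (z * (z - 1)) ^ j) *
      contour 1 r (fun w => b w * ((2 * w - 1) * ((w * (w - 1)) ^ (j + 1))⁻¹)) =
    contour 1 r (fun w => a w * (w - 1) ^ e * b w) := by
  have hr' : 0 < r' := hr.trans hrr
  have hr1 : r < 1 := by linarith
  have hr1' : r' < 1 := by linarith
  have hz0 : ∀ z ∈ sphere (1 : ℂ) r', z ≠ 0 := fun z hz => sphere_one_subset hr1' hz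
  have hw0 : ∀ w ∈ sphere (1 : ℂ) r, w ≠ 0 := fun w hw => sphere_one_subset hr1 hw
  have hd : ∀ z ∈ sphere (1 : ℂ) r', ∀ w ∈ sphere (1 : ℂ) r, (w - z) * (w + z - 1) ≠ 0 := by
    intro z hz w hw
    have h1 := norm_sub_one_of_mem hz
    have h2 := norm_sub_one_of_mem hw
    refine mul_ne_zero (fun h => ?_) fun h => ?_
    · rw [sub_eq_zero.1 h] at h2
      linarith
    · have h3 := (norm_mem_of_mem_sphere_one hz).1
      have : z = -(w - 1) := by linear_combination h
      rw [this, norm_neg, h2] at h3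
      linarith
  have hca : ContinuousOn (fun z => a z * (z - 1) ^ e) (sphere 1 r') :=
    (ha.continuousOn.mono hz0).mul (ContinuousOn.zpow₀ (by fun_prop) _
      fun z hz => Or.inl (ne_of_mem_sphere_one hr' hz))
  have hcb : ContinuousOn b (sphere 1 r) := hb.continuousOn.mono hw0
  have hVne : ∀ w ∈ sphere (1 : ℂ) r, w * (w - 1) ≠ 0 := fun w hw =>
    mul_ne_zero (hw0 w hw) (ne_of_mem_sphere_one hr hw)
  have hcB : ∀ j : ℕ, ContinuousOn
      (fun w => b w * ((2 * w - 1) * ((w * (w - 1)) ^ (j + 1))⁻¹)) (sphere 1 r) := fun j =>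
    hcb.mul (ContinuousOn.mul (by fun_prop)
      (ContinuousOn.inv₀ (by fun_prop) fun w hw => pow_ne_zero _ (hVne w hw)))
  -- The complete part 1 / (V - v) of the finite geometric sum integrates to 0 over w, since both
  -- poles w = z and w = 1 - z lie outside the smaller circle. Only the remainder term survives.
  have step1 : ∀ z ∈ sphere (1 : ℂ) r',
      ∑ j ∈ Finset.range D, a z * (z - 1) ^ e * (z * (z - 1)) ^ j *
        contour 1 r (fun w => b w * ((2 * w - 1) * ((w * (w - 1)) ^ (j + 1))⁻¹)) =
      -contour 1 r (fun w => a z * (z - 1) ^ e * (z * (z - 1)) ^ D *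
        (b w * (2 * w - 1) * ((w * (w - 1)) ^ D)⁻¹ / ((w - z) * (w + z - 1)))) := by
    intro z hz
    have h1 := norm_sub_one_of_mem hz
    have h2 := (norm_mem_of_mem_sphere_one hz).1
    have h0 := contour_kernel_eq_zero hb hr.le hr1 (z := z) (by linarith) (by linarith)
    rw [← zero_sub, ← mul_zero (a z * (z - 1) ^ e), ← h0, ← contour_const_mul]
    rw [← contour_sub hr.le (f := fun w => a z * (z - 1) ^ e *
      (b w * (2 * w - 1) / ((w - z) * (w + z - 1))))]
    · simp_rw [← contour_const_mul]
      rw [← contour_sum hr.le (f := fun j w => a z * (z - 1) ^ e * (z * (z - 1)) ^ j *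
        (b w * ((2 * w - 1) * ((w * (w - 1)) ^ (j + 1))⁻¹)))
        fun j _ => continuousOn_const.mul (hcB j)]
      refine contour_congr hr.le fun w hw => ?_
      have hV := hVne w hw
      have hvV : w * (w - 1) - z * (z - 1) = (w - z) * (w + z - 1) := by ring
      have hg := geom_sum_ratio hV (v := z * (z - 1)) (by rw [hvV]; exact hd z hz w hw) D
      rw [hvV] at hg
      have : ∀ j, a z * (z - 1) ^ e * (z * (z - 1)) ^ j *
          (b w * ((2 * w - 1) * ((w * (w - 1)) ^ (j + 1))⁻¹)) =
          a z * (z - 1) ^ e * b w * (2 * w - 1) *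
          ((z * (z - 1)) ^ j * ((w * (w - 1)) ^ (j + 1))⁻¹) := fun j => by ring
      simp_rw [this]
      rw [← Finset.mul_sum, hg]
      ring
    · exact continuousOn_const.mul ((hcb.mul (by fun_prop)).div (by fun_prop) (hd z hz))
    · exact continuousOn_const.mul (((hcb.mul (by fun_prop)).mul (ContinuousOn.inv₀ (by fun_prop)
        fun w hw => pow_ne_zero _ (hVne w hw))).div (by fun_prop) (hd z hz))
  simp_rw [← contour_mul_const]
  rw [← contour_sum hr'.le (f := fun j z => a z * (z - 1) ^ e * (z * (z - 1)) ^ j *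
      contour 1 r fun w => b w * ((2 * w - 1) * ((w * (w - 1)) ^ (j + 1))⁻¹))
      fun j _ => (hca.mul (by fun_prop)).mul continuousOn_const,
    contour_congr hr'.le step1, contour_neg, contour_swap hr'.le hr.le, ← contour_neg]
  · refine contour_congr hr.le fun w hw => ?_
    have h2w := two_mul_sub_one_ne_zero (by linarith) hw
    have hV := hVne w hw
    have hwn := norm_sub_one_of_mem hw
    have hU : IsOpen ({0}ᶜ ∩ {1 - w}ᶜ : Set ℂ) :=
      isOpen_compl_singleton.inter isOpen_compl_singleton
    obtain ⟨k, hk⟩ := Int.eq_ofNat_of_zero_le hD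
    -- Since e + D ≥ 0, the factor v(z)^D of the remainder removes the pole at z = 1.
    have hpow : ∀ z : ℂ, z - 1 ≠ 0 →
        a z * (z - 1) ^ e * (z * (z - 1)) ^ D = a z * z ^ D * (z - 1) ^ k := by
      intro z hz
      rw [mul_pow, ← zpow_natCast (z - 1) k, ← hk, zpow_add₀ hz, zpow_natCast]
      ring
    -- The only pole in z inside |z - 1| = r' is z = w: the other root satisfies |(1 - w) - 1| = |w|
    -- ≥ 1 - r > r'.
    have h := contour_div_sub (c := 1) (r := r') (p := w)
      (f := fun z => a z * z ^ D * (z - 1) ^ k / (z - (1 - w))) (U := {0}ᶜ ∩ {1 - w}ᶜ) ?_ ?_ ?_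
    · have e1 : contour 1 r' (fun z => a z * (z - 1) ^ e * (z * (z - 1)) ^ D *
          (b w * (2 * w - 1) * ((w * (w - 1)) ^ D)⁻¹ / ((w - z) * (w + z - 1)))) =
          -(b w * (2 * w - 1) * ((w * (w - 1)) ^ D)⁻¹) * contour 1 r'
            (fun z => a z * z ^ D * (z - 1) ^ k / (z - (1 - w)) / (z - w)) := by
        rw [← contour_const_mul]
        refine contour_congr hr'.le fun z hz => ?_
        rw [hpow z (ne_of_mem_sphere_one hr' hz)]
        have h3 := hd z hz w hw
        have h4 : (z - (1 - w)) * (z - w) ≠ 0 := by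
          intro h
          refine h3 ?_
          linear_combination -h
        have h5 : (w - z) * (w + z - 1) = -((z - (1 - w)) * (z - w)) := by ring
        rw [h5, div_div, div_neg]
        ring
      rw [e1, h, ← hpow w (ne_of_mem_sphere_one hr hw)]
      have h6 : w - (1 - w) = 2 * w - 1 := by ring
      rw [h6]
      field_simp
    · refine (((ha.mono inter_subset_left).mul (by fun_prop)).mul (by fun_prop)).div
        (by fun_prop) ?_
      rintro z ⟨-, hz⟩
      exact sub_ne_zero.2 hz
    · intro z hz
      refine ⟨closedBall_one_subset hr1' hz, ?_⟩
      intro h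
      rw [mem_singleton_iff] at h
      have hz' : ‖z - 1‖ ≤ r' := by simpa [dist_eq_norm] using hz
      rw [h, sub_sub_cancel_left, norm_neg] at hz'
      have := (norm_mem_of_mem_sphere_one hw).1
      linarith
    · rw [mem_ball, dist_eq_norm, hwn]
      exact hrr
  · exact continuousOn_kernel (A := fun z => a z * (z - 1) ^ e * (z * (z - 1)) ^ D)
      (B := fun w => b w * (2 * w - 1) * ((w * (w - 1)) ^ D)⁻¹) (hca.mul (by fun_prop)) ((hcb.mul (by fun_prop)).mul
      (ContinuousOn.inv₀ (by fun_prop) fun w hw => pow_ne_zero _ (hVne w hw))) hd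

/-- Induction on the pole order via `dslope` at 1; the leftover powers of z - 1 are integrated
explicitly. -/
lemma contour_outer_inv_pow {a : ℂ → ℂ} (ha : DifferentiableOn ℂ a {0}ᶜ) {ε s R : ℝ} (hε : 0 < ε)
    (hε1 : ε < 1) (hs : 0 < s) (hs1 : s < 1) (hR : 1 < R) (d : ℕ) :
    contour 0 R (fun z => a z * ((z - 1) ^ d)⁻¹) =
      contour 0 ε (fun z => a z * ((z - 1) ^ d)⁻¹) +
        contour 1 s (fun z => a z * ((z - 1) ^ d)⁻¹) := by
  have hR0 : 0 < R := by linarith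
  induction d generalizing a with
  | zero =>
    simp only [pow_zero, inv_one, mul_one]
    rw [contour_zero_radius_eq ha hε hR0, contour_eq_zero isOpen_compl_singleton ha hs.le
      (closedBall_one_subset hs1), add_zero]
  | succ d ih =>
    have hd := (Complex.differentiableOn_dslope (c := 1) (isOpen_compl_singleton.mem_nhds
      (by simp : (1 : ℂ) ∈ ({0}ᶜ : Set ℂ)))).2 ha
    have key : ∀ (c : ℂ) (t : ℝ), 0 < t → (∀ z ∈ sphere c t, z ≠ 0 ∧ z - 1 ≠ 0) →
        contour c t (fun z => a z * ((z - 1) ^ (d + 1))⁻¹) =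
        contour c t (fun z => dslope a 1 z * ((z - 1) ^ d)⁻¹) +
          a 1 * contour c t (fun z => ((z - 1) ^ (d + 1))⁻¹) := by
      intro c t ht hne
      have hi : ∀ k : ℕ, ContinuousOn (fun z : ℂ => ((z - 1) ^ k)⁻¹) (sphere c t) := fun k =>
        ContinuousOn.inv₀ (by fun_prop) fun z hz => pow_ne_zero _ (hne z hz).2
      rw [← contour_const_mul, ← contour_add ht.le
        (f := fun z => dslope a 1 z * ((z - 1) ^ d)⁻¹)
        (g := fun z => a 1 * ((z - 1) ^ (d + 1))⁻¹)
        ((hd.continuousOn.mono fun z hz => (hne z hz).1).mul (hi d))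
        (continuousOn_const.mul (hi _))]
      refine contour_congr ht.le fun z hz => ?_
      have h1 := (hne z hz).2
      have h2 := sub_smul_dslope a 1 z
      simp only [smul_eq_mul] at h2
      rw [pow_succ]
      field_simp
      linear_combination -h2
    have hnorm : ∀ t : ℝ, 0 < t → t ≠ 1 → ∀ z ∈ sphere (0 : ℂ) t, z ≠ 0 ∧ z - 1 ≠ 0 := by
      intro t ht ht1 z hz
      refine ⟨ne_zero_of_mem_sphere_zero ht hz, fun h => ?_⟩
      rw [sub_eq_zero.1 h] at hz
      simp at hz
      exact ht1 hz.symm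
    have hconst : contour 0 R (fun z => ((z - 1) ^ (d + 1))⁻¹) =
        contour 0 ε (fun z => ((z - 1) ^ (d + 1))⁻¹) +
        contour 1 s (fun z => ((z - 1) ^ (d + 1))⁻¹) := by
      have hzero : contour 0 ε (fun z => ((z - 1) ^ (d + 1))⁻¹) = 0 := by
        refine contour_eq_zero (U := {1}ᶜ) isOpen_compl_singleton ?_ hε.le ?_
        · exact DifferentiableOn.inv (by fun_prop) fun z hz => pow_ne_zero _ (sub_ne_zero.2 hz)
        · rintro z hz rfl
          simp at hz
          linarith
      rw [hzero, zero_add]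
      rcases Nat.eq_zero_or_pos d with rfl | hd0
      · simp only [zero_add, pow_one]
        rw [contour_inv_sub (mem_ball_self hs), contour_inv_sub]
        simpa using hR
      · have e : ∀ z : ℂ, ((z - 1) ^ (d + 1))⁻¹ = (z - 1) ^ (-((d : ℤ) + 1)) := by
          intro z
          rw [zpow_neg]
          norm_cast
        simp_rw [e]
        rw [contour_sub_zpow (by omega), contour_sub_zpow (by omega)]
    rw [key 0 R hR0 (hnorm R hR0 hR.ne'), key 0 ε hε (hnorm ε hε hε1.ne),
      key 1 s hs fun z hz => ⟨sphere_one_subset hs1 hz, ne_of_mem_sphere_one hs hz⟩, ih hd, hconst]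
    ring

/-- Moving a contour across a pole at `1`. -/
lemma contour_outer {a : ℂ → ℂ} (ha : DifferentiableOn ℂ a {0}ᶜ) {ε s R : ℝ} (hε : 0 < ε)
    (hε1 : ε < 1) (hs : 0 < s) (hs1 : s < 1) (hR : 1 < R) (e : ℤ) :
    contour 0 R (fun z => a z * (z - 1) ^ e) =
      contour 0 ε (fun z => a z * (z - 1) ^ e) + contour 1 s (fun z => a z * (z - 1) ^ e) := by
  obtain ⟨k, rfl | rfl⟩ := e.eq_nat_or_neg
  · have h := contour_outer_inv_pow (a := fun z => a z * (z - 1) ^ k) (ha.mul (by fun_prop))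
      hε hε1 hs hs1 hR 0
    simpa using h
  · simp only [zpow_neg, zpow_natCast]
    exact contour_outer_inv_pow ha hε hε1 hs hs1 hR k

lemma norm_mul_sub_one_le {ε : ℝ} {z : ℂ} (hz : z ∈ sphere (0 : ℂ) ε) :
    ‖z * (z - 1)‖ ≤ ε * (1 + ε) := by
  have h : ‖z‖ = ε := by simpa using hz
  have h0 : 0 ≤ ε := h ▸ norm_nonneg z
  rw [norm_mul, h]
  have := norm_sub_le z 1
  rw [h, norm_one] at this
  gcongr
  linarith

lemma le_norm_mul_sub_one {r : ℝ} (hr : 0 ≤ r) {w : ℂ} (hw : w ∈ sphere (1 : ℂ) r) :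
    r * (1 - r) ≤ ‖w * (w - 1)‖ := by
  rw [norm_mul, norm_sub_one_of_mem hw, mul_comm]
  exact mul_le_mul_of_nonneg_right (norm_mem_of_mem_sphere_one hw).1 hr

lemma norm_dual_le {r M : ℝ} (hr : 0 < r) (hr1 : r < 1) {b : ℂ → ℂ}
    (hb : ∀ w ∈ sphere (1 : ℂ) r, ‖b w * (2 * w - 1)‖ ≤ M) (j : ℕ) {w : ℂ}
    (hw : w ∈ sphere (1 : ℂ) r) :
    ‖b w * ((2 * w - 1) * ((w * (w - 1)) ^ (j + 1))⁻¹)‖ ≤ M * ((r * (1 - r)) ^ (j + 1))⁻¹ := by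
  have h0 : 0 < r * (1 - r) := mul_pos hr (by linarith)
  rw [← mul_assoc, norm_mul, norm_inv, norm_pow]
  have h1 := hb w hw
  have h2 := le_norm_mul_sub_one hr.le hw
  have : 0 ≤ M := (norm_nonneg _).trans h1
  gcongr

lemma norm_contour_dual_le {r M : ℝ} (hr : 0 < r) (hr1 : r < 1) {b : ℂ → ℂ}
    (hb : ∀ w ∈ sphere (1 : ℂ) r, ‖b w * (2 * w - 1)‖ ≤ M) (j : ℕ) :
    ‖contour 1 r (fun w => b w * ((2 * w - 1) * ((w * (w - 1)) ^ (j + 1))⁻¹))‖ ≤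
      r * (M * ((r * (1 - r)) ^ (j + 1))⁻¹) :=
  norm_contour_le hr.le fun _ hw => norm_dual_le hr hr1 hb j hw

lemma norm_mul_pow_le {ε M : ℝ} {a : ℂ → ℂ}
    (ha : ∀ z ∈ sphere (0 : ℂ) ε, ‖a z‖ ≤ M) (j : ℕ) {z : ℂ} (hz : z ∈ sphere (0 : ℂ) ε) :
    ‖a z * (z * (z - 1)) ^ j‖ ≤ M * (ε * (1 + ε)) ^ j := by
  rw [norm_mul, norm_pow]
  have h1 := ha z hz
  have h2 := norm_mul_sub_one_le hz
  have : 0 ≤ M := (norm_nonneg _).trans h1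
  gcongr

lemma norm_contour_mul_pow_le {ε M : ℝ} (hε : 0 ≤ ε) {a : ℂ → ℂ}
    (ha : ∀ z ∈ sphere (0 : ℂ) ε, ‖a z‖ ≤ M) (j : ℕ) :
    ‖contour 0 ε (fun z => a z * (z * (z - 1)) ^ j)‖ ≤ ε * (M * (ε * (1 + ε)) ^ j) :=
  norm_contour_le hε fun _ hz => norm_mul_pow_le ha j hz

/-- An infinite sum of products of contour integrals around `0` and `1`. -/
lemma hasSum_contour_mul_contour {a b : ℂ → ℂ} (ha : DifferentiableOn ℂ a (ball 0 1 \ {0}))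
    (hb : DifferentiableOn ℂ b {0}ᶜ) {ε r : ℝ} (hε : 0 < ε) (hεr : ε < r) (hr : r < 1 / 2)
    (hq : ε * (1 + ε) < r * (1 - r)) :
    HasSum (fun j : ℕ => contour 0 ε (fun z => a z * (z * (z - 1)) ^ j) *
      contour 1 r (fun w => b w * ((2 * w - 1) * ((w * (w - 1)) ^ (j + 1))⁻¹)))
    (-contour 1 r (fun w => a (1 - w) * b w)) := by
  have hr0 : 0 < r := hε.trans hεr
  have hr1 : r < 1 := by linarith
  have hw0 : ∀ w ∈ sphere (1 : ℂ) r, w ≠ 0 := fun w hw => sphere_one_subset hr1 hw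
  have hVne : ∀ w ∈ sphere (1 : ℂ) r, w * (w - 1) ≠ 0 := fun w hw =>
    mul_ne_zero (hw0 w hw) (ne_of_mem_sphere_one hr0 hw)
  have hcb : ContinuousOn b (sphere 1 r) := hb.continuousOn.mono hw0
  have hca : ∀ s : ℝ, 0 < s → s < 1 → ContinuousOn a (sphere 0 s) := fun s hs hs1 =>
    ha.continuousOn.mono fun z hz => ⟨by simpa [mem_sphere_zero_iff_norm.1 hz] using hs1,
      ne_zero_of_mem_sphere_zero hs hz⟩
  have hd : ∀ s : ℝ, s ≠ r → s < 1 - r → ∀ z ∈ sphere (0 : ℂ) s, ∀ w ∈ sphere (1 : ℂ) r,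
      (w - z) * (w + z - 1) ≠ 0 := by
    intro s hsr hs1 z hz w hw
    have hz' : ‖z‖ = s := by simpa using hz
    have h2 := norm_sub_one_of_mem hw
    have h3 := (norm_mem_of_mem_sphere_one hw).1
    refine mul_ne_zero (fun h => ?_) fun h => ?_
    · rw [sub_eq_zero.1 h] at h3
      linarith
    · have : z = -(w - 1) := by linear_combination h
      rw [this, norm_neg, h2] at hz'
      exact hsr hz'.symm
  obtain ⟨Ma, hMa0, hMa⟩ := exists_bound_sphere (hca ε hε (by linarith))
  obtain ⟨Mb, hMb0, hMb⟩ := exists_bound_sphere (f := fun w => b w * (2 * w - 1))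
    (hcb.mul (by fun_prop))
  set q := ε * (1 + ε) / (r * (1 - r)) with hqdef
  have hrr : 0 < r * (1 - r) := mul_pos hr0 (by linarith)
  have hq0 : 0 ≤ q := by positivity
  have hq1 : q < 1 := (div_lt_one hrr).2 hq
  have hsumq : ∀ c : ℝ, Summable fun j : ℕ => c * q ^ j := fun c =>
    (summable_geometric_of_lt_one hq0 hq1).mul_left c
  have hpt : ∀ z ∈ sphere (0 : ℂ) ε, HasSum (fun j : ℕ => a z * (z * (z - 1)) ^ j *
      contour 1 r (fun w => b w * ((2 * w - 1) * ((w * (w - 1)) ^ (j + 1))⁻¹)))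
      (contour 1 r fun w => a z * (b w * (2 * w - 1) / ((w - z) * (w + z - 1)))) := by
    intro z hz
    simp_rw [← contour_const_mul]
    refine hasSum_contour (u := fun j => (Ma * Mb / (r * (1 - r))) * q ^ j) hr0.le ?_ (hsumq _) ?_ ?_
    · exact fun j => continuousOn_const.mul (hcb.mul (ContinuousOn.mul (by fun_prop)
        (ContinuousOn.inv₀ (by fun_prop) fun w hw => pow_ne_zero _ (hVne w hw))))
    · intro j w hw
      rw [norm_mul]
      refine (mul_le_mul (norm_mul_pow_le hMa j hz) (norm_dual_le hr0 hr1 hMb j hw)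
        (norm_nonneg _) (by positivity)).trans (le_of_eq ?_)
      rw [hqdef, div_pow, pow_succ]
      field_simp
    · intro w hw
      have hV := hVne w hw
      have hw0' := hw0 w hw
      have hw1' := ne_of_mem_sphere_one hr0 hw
      have hne := hd ε hεr.ne (by linarith) z hz w hw
      have hvV : 1 - z * (z - 1) / (w * (w - 1)) = (w - z) * (w + z - 1) / (w * (w - 1)) := by
        field_simp
        ring
      have hlt : ‖z * (z - 1) / (w * (w - 1))‖ < 1 := by
        rw [norm_div, div_lt_one (norm_pos_iff.2 hV)]
        exact ((norm_mul_sub_one_le hz).trans_lt hq).trans_le (le_norm_mul_sub_one hr0.le hw)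
      have h := (hasSum_geometric_of_norm_lt_one hlt).mul_left
        (a z * b w * (2 * w - 1) * (w * (w - 1))⁻¹)
      have e : a z * b w * (2 * w - 1) * (w * (w - 1))⁻¹ *
          (1 - z * (z - 1) / (w * (w - 1)))⁻¹ =
          a z * (b w * (2 * w - 1) / ((w - z) * (w + z - 1))) := by
        rw [hvV, inv_div]
        field_simp
      rw [e] at h
      refine h.congr_fun ?_ |> fun h => h
      intro j
      rw [div_pow, pow_succ (w * (w - 1)), mul_inv]
      ring
  have hsum : HasSum (fun j : ℕ => contour 0 ε (fun z => a z * (z * (z - 1)) ^ j) *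
      contour 1 r (fun w => b w * ((2 * w - 1) * ((w * (w - 1)) ^ (j + 1))⁻¹)))
      (contour 0 ε fun z => contour 1 r fun w =>
        a z * (b w * (2 * w - 1) / ((w - z) * (w + z - 1)))) := by
    simp_rw [← contour_mul_const]
    refine hasSum_contour (u := fun j => (Ma * r * Mb / (r * (1 - r))) * q ^ j) hε.le ?_ (hsumq _)
      ?_ hpt
    · exact fun j => ((hca ε hε (by linarith)).mul (by fun_prop)).mul continuousOn_const
    · intro j z hz
      rw [norm_mul]
      refine (mul_le_mul (norm_mul_pow_le hMa j hz) (norm_contour_dual_le hr0 hr1 hMb j)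
        (norm_nonneg _) (by positivity)).trans (le_of_eq ?_)
      rw [hqdef, div_pow, pow_succ]
      field_simp
  convert hsum using 1
  have hK : ∀ s : ℝ, 0 < s → s ≠ r → s < 1 - r → ContinuousOn (fun p : ℂ × ℂ =>
      a p.1 * (b p.2 * (2 * p.2 - 1) / ((p.2 - p.1) * (p.2 + p.1 - 1))))
      (sphere (0 : ℂ) s ×ˢ sphere (1 : ℂ) r) := fun s hs hsr hs1 =>
    continuousOn_kernel (B := fun w => b w * (2 * w - 1)) (hca s hs (by linarith))
      (hcb.mul (by fun_prop)) (hd s hsr hs1)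
  -- For |z| = 1/2 > r both poles w = z and w = 1 - z lie outside the w-circle, so the double
  -- integral vanishes. Hence the integral over |z| = ε is minus the contribution of the pole
  -- crossed in between, z = 1 - w, of modulus r.
  have hhalf : contour 0 (1 / 2) (fun z => contour 1 r fun w =>
      a z * (b w * (2 * w - 1) / ((w - z) * (w + z - 1)))) = 0 := by
    rw [contour_congr (g := fun _ => 0) (by norm_num) fun z hz => ?_]
    · simpa using contour_const_mul 0 0 (1 / 2) fun _ => 0
    · have hz' : ‖z‖ = 1 / 2 := by simpa using hz
      have hz1 := norm_sub_norm_le (1 : ℂ) z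
      rw [norm_one, hz', norm_sub_rev] at hz1
      rw [contour_const_mul, contour_kernel_eq_zero hb hr0.le hr1 (by linarith) (by linarith),
        mul_zero]
  have hdiff : (contour 0 ε fun z => contour 1 r fun w =>
        a z * (b w * (2 * w - 1) / ((w - z) * (w + z - 1)))) =
      (contour 0 ε fun z => contour 1 r fun w =>
        a z * (b w * (2 * w - 1) / ((w - z) * (w + z - 1)))) -
      contour 0 (1 / 2) (fun z => contour 1 r fun w =>
        a z * (b w * (2 * w - 1) / ((w - z) * (w + z - 1)))) := by rw [hhalf, sub_zero]
  rw [hdiff, contour_swap hε.le hr0.le (hK ε hε hεr.ne (by linarith)),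
    contour_swap (by norm_num) hr0.le (hK (1 / 2) (by norm_num) hr.ne' (by linarith)),
    ← contour_sub_of_circleIntegrable
      (circleIntegrable_contour hε.le hr0.le (hK ε hε hεr.ne (by linarith)))
      (circleIntegrable_contour (by norm_num) hr0.le
        (hK (1 / 2) (by norm_num) hr.ne' (by linarith))), ← contour_neg]
  refine contour_congr hr0.le fun w hw => ?_
  have hwn := norm_sub_one_of_mem hw
  have hwlow := (norm_mem_of_mem_sphere_one hw).1
  have h2w := two_mul_sub_one_ne_zero hr hw
  have hU : IsOpen ((ball 0 1 \ {0}) ∩ {w}ᶜ : Set ℂ) :=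
    (isOpen_ball.sdiff isClosed_singleton).inter isOpen_compl_singleton
  have hp : ‖1 - w‖ = r := by rw [norm_sub_rev, hwn]
  have h := contour_sub_contour_div_sub (c := 0) (p := 1 - w) (r := ε) (R := 1 / 2)
    (f := fun z => a z / (z - w)) hU ?_ hε ?_ (by simpa [hp] using hr) (by simpa [hp] using hεr)
  · have e1 : ∀ s : ℝ, 0 < s → s ≠ r → s < 1 - r → contour 0 s (fun z =>
        a z * (b w * (2 * w - 1) / ((w - z) * (w + z - 1)))) =
        -(b w * (2 * w - 1)) * contour 0 s (fun z => a z / (z - w) / (z - (1 - w))) := by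
      intro s hs hsr hs1
      rw [← contour_const_mul]
      refine contour_congr hs.le fun z hz => ?_
      have h5 : (w - z) * (w + z - 1) = -((z - w) * (z - (1 - w))) := by ring
      rw [h5, div_div, div_neg]
      ring
    rw [e1 ε hε hεr.ne (by linarith), e1 (1 / 2) (by norm_num) hr.ne' (by linarith), ← mul_sub,
      ← neg_sub (contour 0 (1 / 2) _), h]
    have h6 : 1 - w - w = -(2 * w - 1) := by ring
    rw [h6, div_neg]
    generalize 2 * w - 1 = c at h2w ⊢
    field_simp
  · refine (ha.mono inter_subset_left).div (by fun_prop) ?_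
    rintro z ⟨-, hz⟩
    exact sub_ne_zero.2 hz
  · intro z hz
    have hz1 : ‖z‖ ≤ 1 / 2 := by simpa using hz.1
    refine ⟨⟨by simp; linarith, closedBall_diff_ball_zero_subset hε hz⟩, ?_⟩
    rintro rfl
    linarith

/-! ### The shifted kernel rewritten inside the unit disc. -/

/-- The factor of the kernel that depends on `(n₁, t₁), x₁`. -/
noncomputable def leftFun (α β : ℂ) (n₁ n₂ x₁ : ℤ) (z : ℂ) : ℂ :=
  z ^ (-x₁ - n₁ - n₂ - 1) * expFactor α β z * (z - 1) ^ (n₁ - n₂)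

/-- The factor of the kernel that depends on `(n₂, t₂), x₂`. -/
noncomputable def rightFun (α β : ℂ) (n₂ x₂ : ℤ) (w : ℂ) : ℂ :=
  w ^ (x₂ + 2 * n₂) / expFactor α β w

/-- The function `Ψ`, with the contour moved inside the unit disc. -/
noncomputable def leftCoef (α β : ℂ) (ε : ℝ) (n₁ n₂ : ℤ) (j : ℕ) (x₁ : ℤ) : ℂ :=
  contour 0 ε fun z => leftFun α β n₁ n₂ x₁ z * (z * (z - 1)) ^ j

open Classical in
/-- The contribution of the transition function, with the contour inside the unit disc. -/
noncomputable def innerTransition (a b : ℝ → ℝ) (ε : ℝ) (p : ℤ × ℝ) (x₁ : ℤ) (q : ℤ × ℝ)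
    (x₂ : ℤ) : ℂ :=
  if Prec p q then contour 0 ε fun z =>
    leftFun (a p.2) (b p.2) p.1 q.1 x₁ z * rightFun (a q.2) (b q.2) q.1 x₂ z else 0

/-- The product of the two factors of the `j`-th term of the kernel. -/
noncomputable def kernelTerm (a b : ℝ → ℝ) (ε r : ℝ) (p : ℤ × ℝ) (x₁ : ℤ) (q : ℤ × ℝ) (x₂ : ℤ)
    (j : ℕ) : ℂ :=
  leftCoef (a p.2) (b p.2) ε p.1 q.1 j x₁ * dualFun (a q.2) (b q.2) r q.1 j x₂

lemma differentiableOn_rightFun (α β : ℂ) (n₂ x₂ : ℤ) :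
    DifferentiableOn ℂ (rightFun α β n₂ x₂) {0}ᶜ :=
  (differentiableOn_zpow _ _ (Or.inl (by simp))).div (differentiableOn_expFactor α β)
    fun _ _ => expFactor_ne_zero _ _ _

lemma differentiableOn_zpow_expFactor (α β : ℂ) (m : ℤ) :
    DifferentiableOn ℂ (fun z => z ^ m * expFactor α β z) {0}ᶜ :=
  differentiableOn_zpow_mul (differentiableOn_expFactor α β) m

lemma differentiableOn_leftFun (α β : ℂ) (n₁ n₂ x₁ : ℤ) :
    DifferentiableOn ℂ (leftFun α β n₁ n₂ x₁) ({0}ᶜ ∩ {1}ᶜ) := by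
  refine ((differentiableOn_zpow_expFactor α β _).mono inter_subset_left).mul ?_
  intro z hz
  exact ((differentiableAt_id.sub_const (1 : ℂ)).zpow
    (Or.inl (sub_ne_zero.2 hz.2))).differentiableWithinAt

lemma ne_one_of_mem_sphere_zero {s : ℝ} (hs1 : s ≠ 1) {z : ℂ} (hz : z ∈ sphere (0 : ℂ) s) :
    z - 1 ≠ 0 := by
  intro h
  rw [sub_eq_zero.1 h] at hz
  simp at hz
  exact hs1 hz.symm

lemma leftFun_mul_pow {z : ℂ} (hz : z ≠ 0) (hz1 : z - 1 ≠ 0) (α β : ℂ) (n₁ n₂ x₁ : ℤ) (j : ℕ) :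
    leftFun α β n₁ n₂ x₁ z * (z * (z - 1)) ^ j =
      z ^ (-x₁ - n₁ - n₂ - 1 + j) * expFactor α β z * (z - 1) ^ (n₁ - n₂ + j) := by
  unfold leftFun
  rw [mul_pow, zpow_add₀ hz, zpow_add₀ hz1, zpow_natCast, zpow_natCast]
  ring

/-- In the index j = n₂ + N - k the shift N cancels from all exponents. The exponent n₁ - n₂ + j of
z - 1 may be negative, and then shrinking the circle picks up a pole at 1. -/
lemma psi_shift (a b : ℝ → ℝ) {ρ ε r' : ℝ} (hρ : 0 < ρ) (hρ1 : ρ < 1) (hε : 0 < ε) (hε1 : ε < 1)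
    (hr' : 0 < r') (hr1' : r' < 1) {n₁ n₂ N : ℤ} (h₁ : 0 ≤ n₁ + N) {j : ℕ} (hj : j < n₂ + N)
    (t : ℝ) (x : ℤ) :
    psi (fun _ => 1) (fun i => -2 * i) a b ρ (n₁ + N) t (n₂ + N - j) (x - 2 * N) =
      leftCoef (a t) (b t) ε n₁ n₂ j x + contour 1 r' fun z =>
        z ^ (-x - n₁ - n₂ - 1) * expFactor (a t) (b t) z * (z - 1) ^ (n₁ - n₂) *
          (z * (z - 1)) ^ j := by
  have hR : 1 < ρ⁻¹ := (one_lt_inv₀ hρ).2 hρ1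
  have h := contour_outer (differentiableOn_zpow_expFactor (a t) (b t) (-x - n₁ - n₂ - 1 + j)) hε
    hε1 hr' hr1' hR (n₁ - n₂ + j)
  rw [psi_eq a b hρ hρ1 h₁ (by omega)]
  have e1 : -(x - 2 * N) - (n₂ + N - j) - (n₁ + N) - 1 = -x - n₁ - n₂ - 1 + j := by ring
  have e2 : n₁ + N - (n₂ + N - j) = n₁ - n₂ + j := by ring
  simp_rw [mul_right_comm _ (expFactor _ _ _)] at h
  simp_rw [e1, e2]
  rw [h]
  unfold leftCoef
  congr 1
  · refine contour_congr hε.le fun z hz => ?_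
    rw [leftFun_mul_pow (ne_zero_of_mem_sphere_zero hε hz) (ne_one_of_mem_sphere_zero hε1.ne hz),
      mul_right_comm]
  · refine contour_congr hr'.le fun z hz => ?_
    have := leftFun_mul_pow (sphere_one_subset hr1' hz) (ne_of_mem_sphere_one hr' hz) (a t) (b t)
      n₁ n₂ x j
    rw [mul_right_comm, ← this]
    rfl

lemma sum_Icc_eq_sum_range (m : ℤ) (f : ℤ → ℂ) :
    ∑ k ∈ Finset.Icc 1 m, f k = ∑ j ∈ Finset.range m.toNat, f (m - j) := by
  refine Finset.sum_nbij' (fun k => (m - k).toNat) (fun j => m - j) ?_ ?_ ?_ ?_ ?_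
  all_goals intro i hi
  all_goals simp only [Finset.mem_Icc, Finset.mem_range] at hi ⊢
  all_goals try omega
  congr 1
  omega

lemma expFactor_div (α β α' β' z : ℂ) :
    expFactor α β z / expFactor α' β' z = exp ((α - α') * z) * exp ((β - β') / z) := by
  unfold expFactor
  rw [← Complex.exp_sub, ← Complex.exp_add]
  congr 1
  ring

lemma leftFun_mul_rightFun {z : ℂ} (hz : z ≠ 0) (α β α' β' : ℂ) (n₁ n₂ x₁ x₂ : ℤ) :
    leftFun α β n₁ n₂ x₁ z * rightFun α' β' n₂ x₂ z =
      z ^ (x₂ - x₁ - n₁ + n₂ - 1) * (expFactor α β z / expFactor α' β' z) *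
        (z - 1) ^ (n₁ - n₂) := by
  unfold leftFun rightFun
  have : x₂ - x₁ - n₁ + n₂ - 1 = (-x₁ - n₁ - n₂ - 1) + (x₂ + 2 * n₂) := by ring
  rw [this, zpow_add₀ hz (-x₁ - n₁ - n₂ - 1)]
  ring

lemma transition_eq (a b : ℝ → ℝ) {ρ : ℝ} (hρ : 0 < ρ) {p q : ℤ × ℝ} (hpq : Prec p q)
    (x₁ x₂ N : ℤ) :
    transition (fun _ => 1) a b ρ (p.1 + N, p.2) (x₁ - 2 * N) (q.1 + N, q.2) (x₂ - 2 * N) =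
      contour 0 ρ⁻¹ fun z => leftFun (a p.2) (b p.2) p.1 q.1 x₁ z *
        rightFun (a q.2) (b q.2) q.1 x₂ z := by
  have hP : Prec (p.1 + N, p.2) (q.1 + N, q.2) := by
    refine ⟨by simpa using hpq.1, hpq.2.1, fun h => hpq.2.2 ?_⟩
    simp only [Prod.mk.injEq, add_left_inj] at h
    exact Prod.ext h.1 h.2
  unfold transition
  rw [if_pos hP, contour_comp_inv hρ]
  refine contour_congr (inv_pos.2 hρ).le fun z hz => ?_
  have hz0 := ne_zero_of_mem_sphere_zero (inv_pos.2 hρ) hz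
  obtain ⟨d, hd⟩ := Int.eq_ofNat_of_zero_le (sub_nonneg.2 hpq.1)
  have e1 : (1 : ℂ) - z⁻¹ = (z - 1) / z := by field_simp
  have e2 : (q.1 + N - (p.1 + N)).toNat = d := by omega
  have e3 : p.1 - q.1 = -(d : ℤ) := by omega
  have e4 : x₂ - x₁ - p.1 + q.1 - 1 = (x₂ - x₁) + d - 1 := by omega
  have e5 : x₂ - 2 * N - (x₁ - 2 * N) + 1 = x₂ - x₁ + 1 := by ring
  rw [leftFun_mul_rightFun hz0, expFactor_div]
  simp only [ofReal_one, one_mul, Finset.prod_const, Int.card_Ioc, e1, e2, e3, e4, e5,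
    div_inv_eq_mul]
  rw [zpow_sub_one₀ hz0, zpow_add₀ hz0, zpow_neg, zpow_natCast, zpow_natCast, inv_zpow, inv_inv,
    zpow_add_one₀ hz0, div_eq_mul_inv (z - 1) z, mul_pow, inv_pow,
    div_eq_mul_inv (_ - _ : ℂ) z]
  field_simp

/-- The shifted kernel in a form in which all contours but those around `1` lie in the unit
disc. -/
lemma shiftedKernel_eq (a b : ℝ → ℝ) {ρ ε r : ℝ} (hρ : 0 < ρ) (hρ1 : ρ < 1) (hε : 0 < ε)
    (hε1 : ε < 1) (hr : 0 < r) (hr1 : r < 1 / 2) {p q : ℤ × ℝ}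
    (hpq : Prec p q ∨ p = q ∨ Prec q p) {N : ℕ} (h₁ : 0 ≤ p.1 + N) (h₂ : 0 ≤ q.1 + N)
    (x₁ x₂ : ℤ) :
    shiftedKernel a b ρ N p x₁ q x₂ = -innerTransition a b ε p x₁ q x₂ +
      ∑ j ∈ Finset.range (q.1 + N).toNat, kernelTerm a b ε r p x₁ q x₂ j := by
  have hR : 1 < ρ⁻¹ := (one_lt_inv₀ hρ).2 hρ1
  -- The z-circle around 1 must enclose the w-circle, and r + r' < 1 keeps the root 1 - w outside;
  -- this is where r < 1/2 enters.
  obtain ⟨r', hrr, hrr1⟩ := exists_between (show r < 1 - r by linarith)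
  have hr' : 0 < r' := hr.trans hrr
  have hr1' : r' < 1 := by linarith
  have hb := differentiableOn_rightFun (a q.2) (b q.2) q.1 x₂
  unfold shiftedKernel kernel
  simp only
  simp_rw [phi_eq_dualFun a b hρ hρ1 hr (by linarith : r < 1) (q.1 + N) q.2]
  rw [Finset.sum_coe_sort (Finset.Icc (1 : ℤ) (q.1 + N)) (fun k =>
    psi (fun _ => 1) (fun i => -2 * i) a b ρ (p.1 + N) p.2 k (x₁ - 2 * N) *
      dualFun (a q.2) (b q.2) r (q.1 + N) (q.1 + N - k).toNat (x₂ - 2 * N)), sum_Icc_eq_sum_range]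
  have hsum : ∀ j ∈ Finset.range (q.1 + N).toNat,
      psi (fun _ => 1) (fun i => -2 * i) a b ρ (p.1 + N) p.2 (q.1 + N - j) (x₁ - 2 * N) *
        dualFun (a q.2) (b q.2) r (q.1 + N) (q.1 + N - (q.1 + N - j)).toNat (x₂ - 2 * N) =
      kernelTerm a b ε r p x₁ q x₂ j + (contour 1 r' fun z =>
        z ^ (-x₁ - p.1 - q.1 - 1) * expFactor (a p.2) (b p.2) z * (z - 1) ^ (p.1 - q.1) *
          (z * (z - 1)) ^ j) * contour 1 r (fun w => rightFun (a q.2) (b q.2) q.1 x₂ w *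
            ((2 * w - 1) * ((w * (w - 1)) ^ (j + 1))⁻¹)) := by
    intro j hj
    rw [Finset.mem_range] at hj
    rw [psi_shift a b hρ hρ1 hε hε1 hr' hr1' h₁ (by omega), add_mul]
    have e : dualFun (a q.2) (b q.2) r (q.1 + N) (q.1 + N - (q.1 + N - j)).toNat (x₂ - 2 * N) =
        dualFun (a q.2) (b q.2) r q.1 j x₂ := by
      unfold dualFun
      have e1 : (q.1 + N - (q.1 + N - j)).toNat = j := by omega
      have e2 : x₂ - 2 * (N : ℤ) + 2 * (q.1 + N) = x₂ + 2 * q.1 := by ring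
      rw [e1, e2]
    rw [e]
    rfl
  -- With e = n₁ - n₂ and D = n₂ + N terms, the condition e + D ≥ 0 is n₁ + N ≥ 0.
  rw [Finset.sum_congr rfl hsum, Finset.sum_add_distrib,
    sum_contour_mul_contour (differentiableOn_zpow_expFactor _ _ _) hb hr hrr (by linarith)
      (by omega)]
  have hfold : ∀ w, w ^ (-x₁ - p.1 - q.1 - 1) * expFactor (a p.2) (b p.2) w *
      (w - 1) ^ (p.1 - q.1) * rightFun (a q.2) (b q.2) q.1 x₂ w =
      (w ^ (-x₁ - p.1 - q.1 - 1) * expFactor (a p.2) (b p.2) w *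
        rightFun (a q.2) (b q.2) q.1 x₂ w) * (w - 1) ^ (p.1 - q.1) := fun w => by ring
  unfold innerTransition
  -- If p ≺ q, the collected integral around 1 cancels the pole of the transition function.
  -- Otherwise comparability gives n₂ ≤ n₁, so the integrand is holomorphic at 1 and the integral is
  -- 0.
  by_cases h : Prec p q
  · rw [if_pos h, transition_eq a b hρ h]
    unfold leftFun
    simp_rw [hfold]
    rw [contour_outer (a := fun w => w ^ (-x₁ - p.1 - q.1 - 1) * expFactor (a p.2) (b p.2) w *
      rightFun (a q.2) (b q.2) q.1 x₂ w) ((differentiableOn_zpow_expFactor _ _ _).mul hb) hε hε1 hr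
      (by linarith) hR]
    ring
  · have hle : q.1 ≤ p.1 := by
      rcases hpq with h' | rfl | h'
      · exact absurd h' h
      · exact le_rfl
      · exact h'.1
    have hN : ¬Prec (p.1 + N, p.2) (q.1 + N, q.2) := by
      intro h'
      refine h ⟨by simpa using h'.1, h'.2.1, ?_⟩
      rintro rfl
      exact h'.2.2 rfl
    obtain ⟨k, hk⟩ := Int.eq_ofNat_of_zero_le (sub_nonneg.2 hle)
    have hzero : contour 1 r (fun w => w ^ (-x₁ - p.1 - q.1 - 1) * expFactor (a p.2) (b p.2) w *
        (w - 1) ^ (p.1 - q.1) * rightFun (a q.2) (b q.2) q.1 x₂ w) = 0 := by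
      refine contour_eq_zero isOpen_compl_singleton ?_ hr.le (closedBall_one_subset (by linarith))
      rw [hk]
      simp only [zpow_natCast]
      exact ((differentiableOn_zpow_expFactor _ _ _).mul (by fun_prop)).mul hb
    rw [if_neg h, hzero]
    unfold transition
    rw [if_neg hN, add_zero]

/-! ### Pointwise convergence to the flat kernel. -/

lemma hasSum_kernelTerm (a b : ℝ → ℝ) {ε r : ℝ} (hε : 0 < ε) (hεr : ε < r) (hr : r < 1 / 2)
    (hq : ε * (1 + ε) < r * (1 - r)) (p q : ℤ × ℝ) (x₁ x₂ : ℤ) :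
    HasSum (kernelTerm a b ε r p x₁ q x₂) (-contour 1 r fun w =>
      leftFun (a p.2) (b p.2) p.1 q.1 x₁ (1 - w) * rightFun (a q.2) (b q.2) q.1 x₂ w) := by
  refine hasSum_contour_mul_contour ((differentiableOn_leftFun _ _ _ _ _).mono ?_)
    (differentiableOn_rightFun _ _ _ _) hε hεr hr hq
  rintro z ⟨h1, h2⟩
  refine ⟨h2, ?_⟩
  rintro rfl
  simp at h1

lemma neg_one_zpow_mul_sub_one_zpow (z : ℂ) (n : ℤ) : (-1) ^ n * (z - 1) ^ n = (1 - z) ^ n := by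
  rw [← mul_zpow]
  congr 1
  ring

/-- Change of radius of a circle around `0` or `1`, for a function holomorphic off these points. -/
lemma contour_move {c : ℂ} (hc : c = 0 ∨ c = 1) {f : ℂ → ℂ}
    (hf : DifferentiableOn ℂ f ({0}ᶜ ∩ {1}ᶜ)) {s s' : ℝ} (hs : 0 < s) (hs1 : s < 1) (hs' : 0 < s')
    (hs1' : s' < 1) : contour c s f = contour c s' f := by
  have hU : IsOpen ({0}ᶜ ∩ {1}ᶜ : Set ℂ) :=
    isOpen_compl_singleton.inter isOpen_compl_singleton
  have hsub : ∀ s R : ℝ, 0 < s → R < 1 → closedBall c R \ ball c s ⊆ {0}ᶜ ∩ {1}ᶜ := by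
    intro s R hs hR z hz
    rcases hc with rfl | rfl
    · refine ⟨closedBall_diff_ball_zero_subset hs hz, ?_⟩
      rintro rfl
      have := hz.1
      simp at this
      linarith
    · refine ⟨closedBall_one_subset hR hz.1, ?_⟩
      rintro rfl
      exact hz.2 (mem_ball_self hs)
  rcases le_total s s' with h | h
  · exact (contour_eq_of_annulus hU hf hs h (hsub _ _ hs hs1')).symm
  · exact contour_eq_of_annulus hU hf hs' h (hsub _ _ hs' hs1)

lemma differentiableOn_leftFun_mul_rightFun (α β α' β' : ℂ) (n₁ n₂ x₁ x₂ : ℤ) :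
    DifferentiableOn ℂ (fun z => leftFun α β n₁ n₂ x₁ z * rightFun α' β' n₂ x₂ z)
      ({0}ᶜ ∩ {1}ᶜ) :=
  (differentiableOn_leftFun _ _ _ _ _).mul
    ((differentiableOn_rightFun _ _ _ _).mono inter_subset_left)

lemma innerTransition_eq (a b : ℝ → ℝ) {ε ε' : ℝ} (hε : 0 < ε) (hε1 : ε < 1) (hε' : 0 < ε')
    (hε1' : ε' < 1) (p q : ℤ × ℝ) (x₁ x₂ : ℤ) :
    innerTransition a b ε p x₁ q x₂ = innerTransition a b ε' p x₁ q x₂ := by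
  unfold innerTransition
  rw [contour_move (Or.inl rfl) (differentiableOn_leftFun_mul_rightFun _ _ _ _ _ _ _ _) hε hε1 hε'
    hε1']

lemma flatKernel_eq (a b : ℝ → ℝ) {r₀ r₁ ε r : ℝ} (hr₀ : 0 < r₀ ∧ r₀ < 1) (hr₁ : 0 < r₁ ∧ r₁ < 1)
    (hε : 0 < ε) (hε1 : ε < 1) (hr : 0 < r) (hr1 : r < 1) (p q : ℤ × ℝ) (x₁ x₂ : ℤ) :
    flatKernel a b r₀ r₁ p x₁ q x₂ = (-1) ^ (p.1 - q.1) * (-innerTransition a b ε p x₁ q x₂ +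
      -contour 1 r fun w => leftFun (a p.2) (b p.2) p.1 q.1 x₁ (1 - w) *
        rightFun (a q.2) (b q.2) q.1 x₂ w) := by
  have hright := (differentiableOn_rightFun (a q.2) (b q.2) q.1 x₂).mono
    (inter_subset_left (t := ({1}ᶜ : Set ℂ)))
  unfold flatKernel innerTransition
  rw [mul_add]
  congr 1
  · split_ifs with h
    · have hd := differentiableOn_leftFun_mul_rightFun (a p.2) (b p.2) (a q.2) (b q.2) p.1 q.1 x₁ x₂
      rw [mul_neg, neg_inj, contour_move (Or.inl rfl) hd hε hε1 hr₀.1 hr₀.2, ← contour_const_mul]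
      refine contour_congr hr₀.1.le fun z hz => ?_
      have hz0 := ne_zero_of_mem_sphere_zero hr₀.1 hz
      rw [leftFun_mul_rightFun hz0, mul_left_comm, neg_one_zpow_mul_sub_one_zpow]
      have e1 : x₂ - x₁ - p.1 + q.1 - 1 = -(x₁ - x₂ + 1) + (q.1 - p.1) := by ring
      have e2 : p.1 - q.1 = -(q.1 - p.1) := by ring
      rw [e1, e2, zpow_add₀ hz0 (-(x₁ - x₂ + 1)), div_zpow, zpow_neg, zpow_neg]
      unfold expFactor
      ring
    · simp
  · have hd : DifferentiableOn ℂ (fun w => leftFun (a p.2) (b p.2) p.1 q.1 x₁ (1 - w) *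
        rightFun (a q.2) (b q.2) q.1 x₂ w) ({0}ᶜ ∩ {1}ᶜ) := by
      refine ((differentiableOn_leftFun _ _ _ _ _).comp (g := leftFun (a p.2) (b p.2) p.1 q.1 x₁)
        (f := fun w => 1 - w) (by fun_prop) ?_).mul hright
      rintro w ⟨h0, h1⟩
      refine ⟨?_, ?_⟩
      · exact sub_ne_zero.2 (Ne.symm h1)
      · intro h
        apply h0
        rw [mem_singleton_iff] at h ⊢
        linear_combination -h
    rw [mul_neg, neg_inj, contour_move (Or.inr rfl) hd hr hr1 hr₁.1 hr₁.2, ← contour_const_mul]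
    refine contour_congr hr₁.1.le fun w hw => ?_
    have hw0 : w ≠ 0 := sphere_one_subset hr₁.2 hw
    have hw1 : 1 - w ≠ 0 := by
      rw [← neg_sub, neg_ne_zero]
      exact ne_of_mem_sphere_one hr₁.1 hw
    -- At the root z = 1 - w the factor (z - 1)^(n₁-n₂) becomes (-w)^(n₁-n₂), whose sign the
    -- conjugation removes.
    have e1 : (-1 : ℂ) ^ (p.1 - q.1) * (1 - w - 1) ^ (p.1 - q.1) = w ^ (p.1 - q.1) := by
      rw [← mul_zpow]
      congr 1
      ring
    have e2 : p.1 + q.1 + x₂ = (p.1 - q.1) + (x₂ + 2 * q.1) := by ring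
    have e3 : -x₁ - p.1 - q.1 - 1 = -(p.1 + q.1 + x₁ + 1) := by ring
    unfold leftFun rightFun
    rw [e2, e3, zpow_add₀ hw0 (p.1 - q.1), ← e1, zpow_neg]
    unfold expFactor
    ring

/-- Pointwise convergence of the conjugated kernels. -/
lemma tendsto_shiftedKernel (a b : ℝ → ℝ) {ρ r₀ r₁ : ℝ} (hρ : 0 < ρ ∧ ρ < 1)
    (hr₀ : 0 < r₀ ∧ r₀ < 1) (hr₁ : 0 < r₁ ∧ r₁ < 1) {p q : ℤ × ℝ}
    (hpq : Prec p q ∨ p = q ∨ Prec q p) (x₁ x₂ : ℤ) :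
    Tendsto (fun N : ℕ => (-1 : ℂ) ^ (p.1 - q.1) * shiftedKernel a b ρ N p x₁ q x₂)
      atTop (𝓝 (flatKernel a b r₀ r₁ p x₁ q x₂)) := by
  rw [flatKernel_eq a b (ε := 1 / 8) (r := 1 / 4) hr₀ hr₁ (by norm_num) (by norm_num)
    (by norm_num) (by norm_num)]
  refine Tendsto.const_mul _ ?_
  -- The radii 1/8 and 1/4 satisfy ε(1 + ε) = 9/64 < 12/64 = r(1 - r).
  have hs := (hasSum_kernelTerm a b (ε := 1 / 8) (r := 1 / 4) (by norm_num) (by norm_num)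
    (by norm_num) (by norm_num) p q x₁ x₂).tendsto_sum_nat
  have hD : Tendsto (fun N : ℕ => (q.1 + N).toNat) atTop atTop := by
    refine tendsto_atTop.2 fun m => ?_
    filter_upwards [eventually_ge_atTop (m + q.1.natAbs)] with N hN
    omega
  refine (tendsto_const_nhds.add (hs.comp hD)).congr' ?_
  filter_upwards [eventually_ge_atTop (p.1.natAbs + q.1.natAbs)] with N hN
  exact (shiftedKernel_eq a b hρ.1 hρ.2 (by norm_num) (by norm_num) (by norm_num) (by norm_num) hpq
    (by omega) (by omega) x₁ x₂).symm

/-! ### Hadamard's inequality and dominated convergence of Fredholm series. -/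

lemma prod_le_sum_div_card_pow {ι : Type*} [Fintype ι] (z : ι → ℝ) (hz : ∀ i, 0 ≤ z i) :
    ∏ i, z i ≤ ((∑ i, z i) / Fintype.card ι) ^ Fintype.card ι := by
  rcases isEmpty_or_nonempty ι with h | h
  · simp
  have hn : (0 : ℝ) < Fintype.card ι := by exact_mod_cast Fintype.card_pos
  have h1 := Real.geom_mean_le_arith_mean_weighted Finset.univ
    (fun _ : ι => (Fintype.card ι : ℝ)⁻¹) z (fun _ _ => by positivity)
    (by simp [hn.ne']) fun i _ => hz i
  have h2 := pow_le_pow_left₀ (Finset.prod_nonneg fun i _ => Real.rpow_nonneg (hz i) _) h1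
    (Fintype.card ι)
  rw [← Finset.prod_pow, ← Finset.mul_sum, inv_mul_eq_div] at h2
  refine le_trans (le_of_eq (Finset.prod_congr rfl fun i _ => ?_)) h2
  rw [← Real.rpow_natCast, ← Real.rpow_mul (hz i), inv_mul_cancel₀ hn.ne', Real.rpow_one]

open scoped ComplexOrder in
/-- Hadamard's inequality for a matrix with bounded entries. -/
lemma norm_det_sq_le {n : ℕ} (M : Matrix (Fin n) (Fin n) ℂ) {C : ℝ} (hM : ∀ i j, ‖M i j‖ ≤ C) :
    ‖M.det‖ ^ 2 ≤ (n * C ^ 2) ^ n := by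
  have hP := Matrix.posSemidef_self_mul_conjTranspose M
  have hdet : ((‖M.det‖ ^ 2 : ℝ) : ℂ) = (M * M.conjTranspose).det := by
    rw [Matrix.det_mul, Matrix.det_conjTranspose, Complex.star_def, Complex.mul_conj,
      Complex.normSq_eq_norm_sq]
  have hd : ‖M.det‖ ^ 2 = ∏ i, hP.1.eigenvalues i := by
    have h := hP.1.det_eq_prod_eigenvalues
    rw [← hdet] at h
    have h' : ((‖M.det‖ ^ 2 : ℝ) : ℂ) = ((∏ i, hP.1.eigenvalues i : ℝ) : ℂ) := by
      rw [h]
      push_cast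
      rfl
    exact_mod_cast h'
  have htr : ∑ i, hP.1.eigenvalues i = ∑ i, ∑ j, ‖M i j‖ ^ 2 := by
    have h := hP.1.trace_eq_sum_eigenvalues
    have h' : ((∑ i, hP.1.eigenvalues i : ℝ) : ℂ) = ((∑ i, ∑ j, ‖M i j‖ ^ 2 : ℝ) : ℂ) := by
      have e : (M * M.conjTranspose).trace = ((∑ i, ∑ j, ‖M i j‖ ^ 2 : ℝ) : ℂ) := by
        simp only [Matrix.trace, Matrix.diag, Matrix.mul_apply, Matrix.conjTranspose_apply,
          Complex.star_def, Complex.mul_conj, Complex.normSq_eq_norm_sq]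
        push_cast
        rfl
      rw [← e, h]
      push_cast
      rfl
    exact_mod_cast h'
  rw [hd]
  -- The inequality of arithmetic and geometric means for the eigenvalues of M M*, whose product is
  -- |det M|² and whose sum is the sum of all |M i j|².
  refine (prod_le_sum_div_card_pow _ fun i => hP.eigenvalues_nonneg i).trans ?_
  rw [htr, Fintype.card_fin]
  have h0 : 0 ≤ ∑ i, ∑ j, ‖M i j‖ ^ 2 :=
    Finset.sum_nonneg fun i _ => Finset.sum_nonneg fun j _ => by positivity
  refine pow_le_pow_left₀ (by positivity) ?_ n
  rcases Nat.eq_zero_or_pos n with rfl | hn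
  · simp
  rw [div_le_iff₀ (by exact_mod_cast hn)]
  calc ∑ i, ∑ j, ‖M i j‖ ^ 2 ≤ ∑ _i : Fin n, ∑ _j : Fin n, C ^ 2 :=
        Finset.sum_le_sum fun i _ => Finset.sum_le_sum fun j _ =>
          pow_le_pow_left₀ (norm_nonneg _) (hM i j) 2
    _ = n * C ^ 2 * n := by
      simp only [Finset.sum_const, Finset.card_univ, Fintype.card_fin, nsmul_eq_mul]
      ring

variable {X : Type*}

lemma minorDet_conj (K : X → X → ℂ) {c : X → ℂ} (hc : ∀ x, c x ≠ 0) (n : ℕ) (x : Fin n → X) :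
    minorDet (fun u w => c u * K u w * (c w)⁻¹) n x = minorDet K n x := by
  unfold minorDet
  have h1 := Matrix.det_mul_column (fun i => c (x i)) (Matrix.of fun i j => K (x i) (x j))
  have h2 := Matrix.det_mul_row (fun j => (c (x j))⁻¹)
    (Matrix.of fun i j => c (x i) * K (x i) (x j))
  have e : (Matrix.of fun i j => c (x i) * K (x i) (x j) * (c (x j))⁻¹) =
      Matrix.of fun i j => (c (x j))⁻¹ * (Matrix.of fun i j => c (x i) * K (x i) (x j)) i j := by
    ext i j
    simp only [Matrix.of_apply]
    ring
  rw [e, h2]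
  simp only [Matrix.of_apply] at h1
  rw [h1, ← mul_assoc, Finset.prod_inv_distrib,
    inv_mul_cancel₀ (Finset.prod_ne_zero_iff.2 fun i _ => hc _), one_mul]

lemma fredholmDet_conj (K : X → X → ℂ) {c : X → ℂ} (hc : ∀ x, c x ≠ 0) :
    fredholmDet (fun u w => c u * K u w * (c w)⁻¹) = fredholmDet K := by
  unfold fredholmDet
  simp_rw [minorDet_conj K hc]

lemma fredholmSummable_conj (K : X → X → ℂ) {c : X → ℂ} (hc : ∀ x, c x ≠ 0) :
    FredholmSummable (fun u w => c u * K u w * (c w)⁻¹) ↔ FredholmSummable K := by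
  unfold FredholmSummable
  simp_rw [minorDet_conj K hc]

/-- Conjugation by `w` does not change the minor; pulling `g` out of each column leaves a matrix
with entries bounded by `C`, to which Hadamard's inequality applies. -/
lemma norm_minorDet_le {K : X → X → ℂ} {w g : X → ℝ} {C : ℝ} (hw : ∀ x, 0 < w x)
    (hg : ∀ x, 0 < g x) (hK : ∀ x y, w x * ‖K x y‖ ≤ w y * (C * g y)) (n : ℕ) (x : Fin n → X) :
    ‖minorDet K n x‖ ≤ Real.sqrt ((n * C ^ 2) ^ n) * ∏ i, g (x i) := by
  have hwc : ∀ x, (w x : ℂ) ≠ 0 := fun x => by exact_mod_cast (hw x).ne'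
  have hgc : ∀ x, (g x : ℂ) ≠ 0 := fun x => by exact_mod_cast (hg x).ne'
  rw [← minorDet_conj K hwc]
  set L : Matrix (Fin n) (Fin n) ℂ := Matrix.of fun i j =>
    (w (x i) : ℂ) * K (x i) (x j) * (w (x j) : ℂ)⁻¹ * (g (x j) : ℂ)⁻¹ with hL
  have e : minorDet (fun u v => (w u : ℂ) * K u v * (w v : ℂ)⁻¹) n x =
      (∏ j, (g (x j) : ℂ)) * L.det := by
    rw [← Matrix.det_mul_row]
    unfold minorDet
    congr 1
    ext i j
    simp only [Matrix.of_apply, hL]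
    have := hgc (x j)
    field_simp
  have hLb : ∀ i j, ‖L i j‖ ≤ C := by
    intro i j
    simp only [hL, Matrix.of_apply, norm_mul, norm_inv, Complex.norm_real, Real.norm_eq_abs,
      abs_of_pos (hw _), abs_of_pos (hg _)]
    rw [mul_inv_le_iff₀ (hg _), mul_inv_le_iff₀ (hw _), mul_comm _ (w (x j))]
    exact hK _ _
  rw [e, norm_mul, norm_prod, mul_comm]
  simp only [Complex.norm_real, Real.norm_eq_abs, abs_of_pos (hg _)]
  refine mul_le_mul_of_nonneg_right ?_ (Finset.prod_nonneg fun i _ => (hg _).le)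
  exact Real.le_sqrt_of_sq_le (norm_det_sq_le L hLb)

lemma hasSum_prod_pi {g : X → ℝ} (hg : ∀ x, 0 ≤ g x) (hs : Summable g) (n : ℕ) :
    HasSum (fun x : Fin n → X => ∏ i, g (x i)) ((∑' x, g x) ^ n) := by
  induction n with
  | zero =>
    simp only [Finset.univ_eq_empty, Finset.prod_empty, pow_zero]
    exact hasSum_unique _
  | succ n ih =>
    set P : (Fin n → X) → ℝ := fun x => ∏ i, g (x i) with hP
    have hP0 : 0 ≤ P := fun x => Finset.prod_nonneg fun i _ => hg _
    have hg0 : 0 ≤ g := hg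
    have hsm : Summable fun p : X × (Fin n → X) => g p.1 * P p.2 :=
      Summable.mul_of_nonneg (f := g) (g := P) hs ih.summable hg0 hP0
    have h : HasSum (fun p : X × (Fin n → X) => g p.1 * P p.2)
        ((∑' x, g x) * (∑' x, g x) ^ n) := HasSum.mul (f := g) (g := P) hs.hasSum ih hsm
    let e : X × (Fin n → X) ≃ (Fin (n + 1) → X) := Fin.consEquiv fun _ => X
    rw [← e.hasSum_iff, pow_succ']
    refine h.congr_fun ?_ |> fun h => h
    intro p
    simp [e, hP, Fin.consEquiv, Fin.prod_univ_succ]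

lemma summable_hadamard (C G : ℝ) (hG : 0 ≤ G) :
    Summable fun n : ℕ => (n.factorial : ℝ)⁻¹ * (Real.sqrt ((n * C ^ 2) ^ n) * G ^ n) := by
  have h1 : Summable fun n : ℕ => (4 * Real.exp 1 * C ^ 2 * G ^ 2) ^ n / (n.factorial : ℝ) +
      (1 / 4 : ℝ) ^ n :=
    (Real.summable_pow_div_factorial _).add
      (summable_geometric_of_lt_one (by norm_num) (by norm_num))
  refine Summable.of_nonneg_of_le (fun n => by positivity) (fun n => ?_) h1
  have hf : (0 : ℝ) < n.factorial := by exact_mod_cast n.factorial_pos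
  set t := (n.factorial : ℝ)⁻¹ * (Real.sqrt ((n * C ^ 2) ^ n) * G ^ n) with ht
  have ht0 : 0 ≤ t := by positivity
  have h2 : t ^ 2 * 4 ^ n ≤ (4 * Real.exp 1 * C ^ 2 * G ^ 2) ^ n / (n.factorial : ℝ) := by
    have h3 := Real.pow_div_factorial_le_exp (n : ℝ) n.cast_nonneg n
    have h4 : Real.exp n = Real.exp 1 ^ n := by rw [← Real.exp_nat_mul, mul_one]
    rw [h4] at h3
    have h5 : t ^ 2 * 4 ^ n = ((n : ℝ) ^ n / n.factorial) * (4 * C ^ 2 * G ^ 2) ^ n / n.factorial := by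
      rw [ht, mul_pow, mul_pow, Real.sq_sqrt (by positivity), mul_pow, mul_pow, mul_pow]
      field_simp
      ring
    rw [h5]
    have h6 : (4 * Real.exp 1 * C ^ 2 * G ^ 2) ^ n =
        Real.exp 1 ^ n * (4 * C ^ 2 * G ^ 2) ^ n := by
      rw [← mul_pow]
      congr 1
      ring
    rw [h6]
    gcongr
  have h7 : (0 : ℝ) < 2 ^ n := by positivity
  -- From 2xy ≤ x² + y² with x = 2^n t and y = 2^(-n). Squaring t turns the root of n^n into n^n /
  -- n! ≤ e^n and leaves one more 1 / n!.
  have h8 : t ≤ t ^ 2 * 4 ^ n + (1 / 4 : ℝ) ^ n := by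
    have e1 : (4 : ℝ) ^ n = (2 ^ n) ^ 2 := by rw [← pow_mul, mul_comm, pow_mul]; norm_num
    have e2 : (1 / 4 : ℝ) ^ n = ((2 ^ n)⁻¹) ^ 2 := by
      rw [one_div, inv_pow, e1, inv_pow]
    rw [e1, e2, ← mul_pow]
    have e3 : t = (t * 2 ^ n) * (2 ^ n)⁻¹ := by field_simp
    have h9 := two_mul_le_add_sq (t * 2 ^ n) ((2 ^ n : ℝ)⁻¹)
    have : 2 * (t * 2 ^ n) * (2 ^ n : ℝ)⁻¹ = 2 * t := by field_simp
    linarith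
  linarith

lemma fredholmSummable_of_bound {K : X → X → ℂ} {w g : X → ℝ} {C : ℝ} (hw : ∀ x, 0 < w x)
    (hg : ∀ x, 0 < g x) (hs : Summable g) (hK : ∀ x y, w x * ‖K x y‖ ≤ w y * (C * g y)) :
    FredholmSummable K := by
  have hp := hasSum_prod_pi (fun x => (hg x).le) hs
  have hsum : ∀ n : ℕ, Summable fun x : Fin n → X => ‖minorDet K n x‖ := fun n =>
    Summable.of_nonneg_of_le (fun _ => norm_nonneg _) (norm_minorDet_le hw hg hK n)
      ((hp n).summable.mul_left _)
  refine ⟨hsum, ?_⟩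
  refine Summable.of_nonneg_of_le (fun n => mul_nonneg (by positivity)
    (tsum_nonneg fun _ => norm_nonneg _)) (fun n => ?_)
    (summable_hadamard C (∑' x, g x) (tsum_nonneg fun x => (hg x).le))
  refine mul_le_mul_of_nonneg_left ?_ (by positivity)
  refine ((hsum n).tsum_le_tsum (norm_minorDet_le hw hg hK n)
    ((hp n).summable.mul_left _)).trans (le_of_eq ?_)
  rw [tsum_mul_left, (hp n).tsum_eq]

/-- Dominated convergence for Fredholm determinants. -/
lemma tendsto_fredholmDet {Kn : ℕ → X → X → ℂ} {K : X → X → ℂ} {w g : X → ℝ} {C : ℝ}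
    (hw : ∀ x, 0 < w x) (hg : ∀ x, 0 < g x) (hs : Summable g)
    (hKn : ∀ᶠ N in atTop, ∀ x y, w x * ‖Kn N x y‖ ≤ w y * (C * g y))
    (hlim : ∀ x y, Tendsto (fun N => Kn N x y) atTop (𝓝 (K x y))) :
    (∀ᶠ N in atTop, FredholmSummable (Kn N)) ∧ FredholmSummable K ∧
      Tendsto (fun N => fredholmDet (Kn N)) atTop (𝓝 (fredholmDet K)) := by
  have hp := hasSum_prod_pi (fun x => (hg x).le) hs
  have hK : ∀ x y, w x * ‖K x y‖ ≤ w y * (C * g y) := fun x y =>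
    le_of_tendsto (((hlim x y).norm).const_mul (w x)) (hKn.mono fun N h => h x y)
  refine ⟨hKn.mono fun N h => fredholmSummable_of_bound hw hg hs h,
    fredholmSummable_of_bound hw hg hs hK, ?_⟩
  have hdet : ∀ n (x : Fin n → X), Tendsto (fun N => minorDet (Kn N) n x) atTop
      (𝓝 (minorDet K n x)) := by
    intro n x
    have hM : Tendsto (fun N => (Matrix.of fun i j => Kn N (x i) (x j) : Matrix (Fin n) (Fin n) ℂ))
        atTop (𝓝 (Matrix.of fun i j => K (x i) (x j))) :=
      tendsto_pi_nhds.2 fun i => tendsto_pi_nhds.2 fun j => hlim _ _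
    exact ((continuous_id.matrix_det).tendsto _).comp hM
  unfold fredholmDet
  refine tendsto_tsum_of_dominated_convergence
    (summable_hadamard C (∑' x, g x) (tsum_nonneg fun x => (hg x).le)) (fun n => ?_) ?_
  · refine Tendsto.const_mul _ ?_
    exact tendsto_tsum_of_dominated_convergence ((hp n).summable.mul_left _) (hdet n)
      (hKn.mono fun N h x => norm_minorDet_le hw hg h n x)
  · filter_upwards [hKn] with N h n
    rw [norm_mul, norm_div, norm_pow, norm_neg, norm_one, one_pow, Complex.norm_natCast, one_div]
    refine mul_le_mul_of_nonneg_left ?_ (by positivity)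
    refine (tsum_of_norm_bounded ((hp n).mul_left _) (norm_minorDet_le hw hg h n))

/-! ### Kernel bounds uniform in N, and the limit of the determinants. -/

lemma Prec.not_prec {p q : ℤ × ℝ} (h : Prec p q) : ¬Prec q p := fun h' =>
  h.2.2 (Prod.ext (le_antisymm h.1 h'.1) (le_antisymm h'.2.1 h.2.1))

lemma zpow_le_half_pow {t : ℝ} (ht : 2 ≤ t) (s : ℤ) :
    ∃ C, 0 ≤ C ∧ ∀ x < s, t ^ x ≤ C * (1 / 2 : ℝ) ^ x.natAbs := by
  have ht0 : 0 < t := by linarith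
  refine ⟨t ^ s * 2 ^ (-s) * 4 ^ s.natAbs, by positivity, fun x hx => ?_⟩
  obtain ⟨k, hk⟩ := Int.eq_ofNat_of_zero_le (sub_nonneg.2 hx.le)
  have h1 : t ^ x ≤ t ^ s * 2 ^ (x - s) := by
    have e1 : x = s + -(k : ℤ) := by omega
    have e2 : x - s = -(k : ℤ) := by omega
    rw [e2, e1, zpow_add₀ ht0.ne']
    refine mul_le_mul_of_nonneg_left ?_ (by positivity)
    rw [zpow_neg, zpow_neg, zpow_natCast, zpow_natCast]
    exact inv_anti₀ (by positivity) (pow_le_pow_left₀ (by norm_num) ht k)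
  have h2 : (2 : ℝ) ^ x ≤ 4 ^ s.natAbs * (1 / 2 : ℝ) ^ x.natAbs := by
    obtain ⟨l, rfl | rfl⟩ := x.eq_nat_or_neg
    · have e : (2 : ℝ) ^ (l : ℤ) = 4 ^ l * (1 / 2 : ℝ) ^ l := by
        rw [← mul_pow, zpow_natCast]
        norm_num
      rw [e, Int.natAbs_natCast]
      gcongr
      · norm_num
      · omega
    · rw [zpow_neg, zpow_natCast, Int.natAbs_neg, Int.natAbs_natCast, one_div, inv_pow]
      exact le_mul_of_one_le_left (by positivity) (one_le_pow₀ (by norm_num))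
  calc t ^ x ≤ t ^ s * 2 ^ (x - s) := h1
    _ = t ^ s * 2 ^ (-s) * 2 ^ x := by
      rw [sub_eq_add_neg, zpow_add₀ (by norm_num)]
      ring
    _ ≤ t ^ s * 2 ^ (-s) * (4 ^ s.natAbs * (1 / 2 : ℝ) ^ x.natAbs) := by gcongr
    _ = _ := by ring

lemma summable_half_pow_natAbs : Summable fun x : ℤ => (1 / 2 : ℝ) ^ x.natAbs := by
  have h : Summable fun n : ℕ => (1 / 2 : ℝ) ^ n :=
    summable_geometric_of_lt_one (by norm_num) (by norm_num)
  refine Summable.of_nat_of_neg ?_ ?_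
  · simpa using h
  · simpa using h

lemma norm_innerTransition_le (a b : ℝ → ℝ) {ε : ℝ} (hε : 0 < ε) (hε1 : ε < 1) (p q : ℤ × ℝ) :
    ∃ C, 0 ≤ C ∧ ∀ x₁ x₂, ‖innerTransition a b ε p x₁ q x₂‖ ≤ C * ε ^ (x₂ - x₁) := by
  have hd := differentiableOn_leftFun_mul_rightFun (a p.2) (b p.2) (a q.2) (b q.2) p.1 q.1 0 0
  obtain ⟨M, hM0, hM⟩ := exists_bound_sphere (c := 0) (r := ε) (hd.continuousOn.mono fun z hz =>
    ⟨ne_zero_of_mem_sphere_zero hε hz, sub_ne_zero.1 (ne_one_of_mem_sphere_zero hε1.ne hz)⟩)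
  refine ⟨ε * M, by positivity, fun x₁ x₂ => ?_⟩
  unfold innerTransition
  split_ifs with h
  · have : ‖contour 0 ε fun z => leftFun (a p.2) (b p.2) p.1 q.1 x₁ z *
        rightFun (a q.2) (b q.2) q.1 x₂ z‖ ≤ ε * (M * ε ^ (x₂ - x₁)) := by
      refine norm_contour_le hε.le fun z hz => ?_
      have hz0 := ne_zero_of_mem_sphere_zero hε hz
      have hz' : ‖z‖ = ε := by simpa using hz
      have e : leftFun (a p.2) (b p.2) p.1 q.1 x₁ z * rightFun (a q.2) (b q.2) q.1 x₂ z =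
          leftFun (a p.2) (b p.2) p.1 q.1 0 z * rightFun (a q.2) (b q.2) q.1 0 z *
            z ^ (x₂ - x₁) := by
        rw [leftFun_mul_rightFun hz0, leftFun_mul_rightFun hz0]
        have : x₂ - x₁ - p.1 + q.1 - 1 = (0 - 0 - p.1 + q.1 - 1) + (x₂ - x₁) := by ring
        rw [this, zpow_add₀ hz0 (0 - 0 - p.1 + q.1 - 1)]
        ring
      rw [e, norm_mul, norm_zpow, hz']
      exact mul_le_mul_of_nonneg_right (hM z hz) (by positivity)
    linarith
  · rw [norm_zero]
    positivity

/-- The j-th term carries the ratio t = ε(1 + ε) / (r(1 - r)) < 1 to the power j, so the bound does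
not depend on the number of terms. The cut x₂ < s gives |w|^(x₂-s) ≤ (1 - r)^(x₂-s), by |w| ≥ 1 - r.
-/
lemma norm_sum_kernelTerm_le (a b : ℝ → ℝ) {ε r : ℝ} (hε : 0 < ε) (hε1 : ε < 1) (hr : 0 < r)
    (hr1 : r < 1) (hq : ε * (1 + ε) < r * (1 - r)) (p q : ℤ × ℝ) (s : ℤ) :
    ∃ C, 0 ≤ C ∧ ∀ (D : ℕ) (x₁ x₂ : ℤ), x₂ < s →
      ‖∑ j ∈ Finset.range D, kernelTerm a b ε r p x₁ q x₂ j‖ ≤ C * (ε ^ (-x₁) * (1 - r) ^ x₂) := by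
  have hr1' : 0 < 1 - r := by linarith
  obtain ⟨Ma, hMa0, hMa⟩ := exists_bound_sphere (c := 0) (r := ε)
    ((differentiableOn_leftFun (a p.2) (b p.2) p.1 q.1 0).continuousOn.mono fun z hz =>
      ⟨ne_zero_of_mem_sphere_zero hε hz, sub_ne_zero.1 (ne_one_of_mem_sphere_zero hε1.ne hz)⟩)
  obtain ⟨Mb, hMb0, hMb⟩ := exists_bound_sphere (c := 1) (r := r)
    (f := fun w => rightFun (a q.2) (b q.2) q.1 s w * (2 * w - 1))
    (((differentiableOn_rightFun (a q.2) (b q.2) q.1 s).continuousOn.mono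
      (sphere_one_subset hr1)).mul (by fun_prop))
  set t := ε * (1 + ε) / (r * (1 - r)) with ht
  have hrr : 0 < r * (1 - r) := mul_pos hr hr1'
  have ht0 : 0 ≤ t := by positivity
  have ht1 : t < 1 := (div_lt_one hrr).2 hq
  refine ⟨ε * Ma * r * Mb * (1 - r) ^ (-s) / (r * (1 - r)) * (1 - t)⁻¹, ?_, fun D x₁ x₂ hx₂ => ?_⟩
  · have : 0 < 1 - t := by linarith
    positivity
  have hA : ∀ z ∈ sphere (0 : ℂ) ε, ‖leftFun (a p.2) (b p.2) p.1 q.1 x₁ z‖ ≤ Ma * ε ^ (-x₁) := by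
    intro z hz
    have hz0 := ne_zero_of_mem_sphere_zero hε hz
    have hz' : ‖z‖ = ε := by simpa using hz
    have e : leftFun (a p.2) (b p.2) p.1 q.1 x₁ z =
        leftFun (a p.2) (b p.2) p.1 q.1 0 z * z ^ (-x₁) := by
      unfold leftFun
      have : -x₁ - p.1 - q.1 - 1 = (-0 - p.1 - q.1 - 1) + -x₁ := by ring
      rw [this, zpow_add₀ hz0 (-0 - p.1 - q.1 - 1)]
      ring
    rw [e, norm_mul, norm_zpow, hz']
    exact mul_le_mul_of_nonneg_right (hMa z hz) (by positivity)
  have hB : ∀ w ∈ sphere (1 : ℂ) r, ‖rightFun (a q.2) (b q.2) q.1 x₂ w * (2 * w - 1)‖ ≤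
      Mb * (1 - r) ^ (x₂ - s) := by
    intro w hw
    have hw0 : w ≠ 0 := sphere_one_subset hr1 hw
    have e : rightFun (a q.2) (b q.2) q.1 x₂ w * (2 * w - 1) =
        rightFun (a q.2) (b q.2) q.1 s w * (2 * w - 1) * w ^ (x₂ - s) := by
      unfold rightFun
      have : x₂ + 2 * q.1 = (s + 2 * q.1) + (x₂ - s) := by ring
      rw [this, zpow_add₀ hw0 (s + 2 * q.1)]
      ring
    rw [e, norm_mul, norm_zpow]
    refine mul_le_mul (hMb w hw) ?_ (by positivity) hMb0
    obtain ⟨k, hk⟩ := Int.eq_ofNat_of_zero_le (sub_nonneg.2 hx₂.le)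
    have e2 : x₂ - s = -(k : ℤ) := by omega
    rw [e2, zpow_neg, zpow_neg, zpow_natCast, zpow_natCast]
    exact inv_anti₀ (by positivity)
      (pow_le_pow_left₀ hr1'.le (norm_mem_of_mem_sphere_one hw).1 k)
  have hterm : ∀ j, ‖kernelTerm a b ε r p x₁ q x₂ j‖ ≤
      ε * Ma * r * Mb * (1 - r) ^ (-s) / (r * (1 - r)) * (ε ^ (-x₁) * (1 - r) ^ x₂) * t ^ j := by
    intro j
    unfold kernelTerm
    rw [norm_mul]
    refine (mul_le_mul (norm_contour_mul_pow_le hε.le hA j) (norm_contour_dual_le hr hr1 hB j)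
      (norm_nonneg _) (by positivity)).trans (le_of_eq ?_)
    rw [ht, div_pow, pow_succ, sub_eq_add_neg x₂ s, zpow_add₀ hr1'.ne']
    field_simp
  calc ‖∑ j ∈ Finset.range D, kernelTerm a b ε r p x₁ q x₂ j‖
      ≤ ∑ j ∈ Finset.range D, ε * Ma * r * Mb * (1 - r) ^ (-s) / (r * (1 - r)) *
          (ε ^ (-x₁) * (1 - r) ^ x₂) * t ^ j := norm_sum_le_of_le _ fun j _ => hterm j
    _ ≤ ε * Ma * r * Mb * (1 - r) ^ (-s) / (r * (1 - r)) * (ε ^ (-x₁) * (1 - r) ^ x₂) *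
          (1 - t)⁻¹ := by
        rw [← Finset.mul_sum]
        refine mul_le_mul_of_nonneg_left ?_ (by positivity)
        rw [← tsum_geometric_of_lt_one ht0 ht1]
        exact (summable_geometric_of_lt_one ht0 ht1).sum_le_tsum _ fun j _ => by positivity
    _ = _ := by ring

/-- The two parts decay in x₂ → -∞ for different reasons: the transition part like (u / v)^x₂, which
is needed only if p ≺ q, and the sum like ((1 - r) / v)^x₂. In x₁ the sum contributes (u / ε)^x₁,
bounded for x₁ < s₁ since ε ≤ u. -/
lemma weighted_kernel_le (a b : ℝ → ℝ) {ε r u v : ℝ} (hε : 0 < ε) (hε1 : ε < 1) (hr : 0 < r)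
    (hr1 : r < 1) (hq : ε * (1 + ε) < r * (1 - r)) (hu1 : u < 1) (hεu : ε ≤ u) (hv : 0 < v)
    (hrv : 2 ≤ (1 - r) / v) {p q : ℤ × ℝ} (huv : Prec p q → 2 ≤ u / v) (s₁ s₂ : ℤ) :
    ∃ C, 0 ≤ C ∧ ∀ (D : ℕ) (x₁ x₂ : ℤ), x₁ < s₁ → x₂ < s₂ →
      u ^ x₁ * ‖-innerTransition a b ε p x₁ q x₂ +
        ∑ j ∈ Finset.range D, kernelTerm a b ε r p x₁ q x₂ j‖ ≤
        v ^ x₂ * (C * (1 / 2) ^ x₂.natAbs) := by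
  have hu : 0 < u := hε.trans_le hεu
  have hr1' : 0 < 1 - r := by linarith
  obtain ⟨C₁, hC₁, h₁⟩ : ∃ C, 0 ≤ C ∧ ∀ x₁ x₂ : ℤ, x₂ < s₂ →
      u ^ x₁ * ‖innerTransition a b ε p x₁ q x₂‖ ≤ v ^ x₂ * (C * (1 / 2) ^ x₂.natAbs) := by
    by_cases hpq : Prec p q
    · obtain ⟨A, hA0, hA⟩ := norm_innerTransition_le a b hu hu1 p q
      obtain ⟨B, hB0, hB⟩ := zpow_le_half_pow (huv hpq) s₂
      refine ⟨A * B, by positivity, fun x₁ x₂ hx₂ => ?_⟩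
      -- Taking the radius equal to the weight u makes u^x₁ cancel u^(-x₁) exactly.
      rw [innerTransition_eq a b hε hε1 hu hu1]
      calc u ^ x₁ * ‖innerTransition a b u p x₁ q x₂‖
          ≤ u ^ x₁ * (A * u ^ (x₂ - x₁)) := by gcongr; exact hA x₁ x₂
        _ = v ^ x₂ * (A * (u / v) ^ x₂) := by
          rw [zpow_sub₀ hu.ne', div_zpow]
          have := (zpow_pos hv x₂).ne'
          have := (zpow_pos hu x₁).ne'
          field_simp
        _ ≤ v ^ x₂ * (A * (B * (1 / 2) ^ x₂.natAbs)) := by gcongr; exact hB x₂ hx₂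
        _ = _ := by ring
    · refine ⟨0, le_rfl, fun x₁ x₂ _ => ?_⟩
      simp [innerTransition, hpq]
  obtain ⟨A, hA0, hA⟩ := norm_sum_kernelTerm_le a b hε hε1 hr hr1 hq p q s₂
  obtain ⟨B, hB0, hB⟩ := zpow_le_half_pow hrv s₂
  refine ⟨C₁ + A * (u / ε) ^ s₁ * B, by positivity, fun D x₁ x₂ hx₁ hx₂ => ?_⟩
  have h₂ : u ^ x₁ * ‖∑ j ∈ Finset.range D, kernelTerm a b ε r p x₁ q x₂ j‖ ≤
      v ^ x₂ * (A * (u / ε) ^ s₁ * B * (1 / 2) ^ x₂.natAbs) := by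
    calc u ^ x₁ * ‖∑ j ∈ Finset.range D, kernelTerm a b ε r p x₁ q x₂ j‖
        ≤ u ^ x₁ * (A * (ε ^ (-x₁) * (1 - r) ^ x₂)) := by gcongr; exact hA D x₁ x₂ hx₂
      _ = v ^ x₂ * (A * (u / ε) ^ x₁ * ((1 - r) / v) ^ x₂) := by
        rw [zpow_neg, div_zpow, div_zpow]
        have := (zpow_pos hv x₂).ne'
        field_simp
      _ ≤ v ^ x₂ * (A * (u / ε) ^ s₁ * (B * (1 / 2) ^ x₂.natAbs)) := by
        have h3 : (u / ε) ^ x₁ ≤ (u / ε) ^ s₁ :=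
          zpow_le_zpow_right₀ ((one_le_div hε).2 hεu) hx₁.le
        have h4 := hB x₂ hx₂
        gcongr
      _ = _ := by ring
  calc u ^ x₁ * ‖-innerTransition a b ε p x₁ q x₂ +
        ∑ j ∈ Finset.range D, kernelTerm a b ε r p x₁ q x₂ j‖
      ≤ u ^ x₁ * (‖innerTransition a b ε p x₁ q x₂‖ +
        ‖∑ j ∈ Finset.range D, kernelTerm a b ε r p x₁ q x₂ j‖) := by
        gcongr
        exact (norm_add_le _ _).trans_eq (by rw [norm_neg])
    _ ≤ v ^ x₂ * (C₁ * (1 / 2) ^ x₂.natAbs) +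
        v ^ x₂ * (A * (u / ε) ^ s₁ * B * (1 / 2) ^ x₂.natAbs) := by
        rw [mul_add]
        exact add_le_add (h₁ x₁ x₂ hx₂) h₂
    _ = _ := by ring

/-- A bound on the cut kernels that is uniform in `N`. -/
lemma eventually_cutKernel_le (a b : ℝ → ℝ) {ρ : ℝ} (hρ : 0 < ρ ∧ ρ < 1) {m : ℕ}
    (p : Fin m → ℤ × ℝ) (s : Fin m → ℤ) (hp : ∀ i j, i < j → Prec (p i) (p j)) :
    ∃ C, ∀ᶠ N : ℕ in atTop, ∀ x y : Fin m × ℤ,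
      ((1 / 4 : ℝ) ^ ((x.1 : ℕ) + 1)) ^ x.2 * ‖cutKernel p s (shiftedKernel a b ρ N) x y‖ ≤
        ((1 / 4 : ℝ) ^ ((y.1 : ℕ) + 1)) ^ y.2 * (C * (1 / 2) ^ y.2.natAbs) := by
  -- The weights (1/4)^(i+1), i < m, drop by a factor of at least 4 along the sequence and all
  -- exceed r; with ε = r / 4 and r ≤ 1/4 the conditions of `weighted_kernel_le` hold for every
  -- pair.
  set r : ℝ := (1 / 4) ^ (m + 1) with hr
  have hr0 : 0 < r := by positivity
  have hr4 : r ≤ 1 / 4 := by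
    rw [hr, pow_succ]
    exact mul_le_of_le_one_left (by norm_num) (pow_le_one₀ (by norm_num) (by norm_num))
  have hu4 : ∀ i : Fin m, (1 / 4 : ℝ) ^ ((i : ℕ) + 1) ≤ 1 / 4 := by
    intro i
    rw [pow_succ]
    exact mul_le_of_le_one_left (by norm_num) (pow_le_one₀ (by norm_num) (by norm_num))
  have hcmp : ∀ i j : Fin m, Prec (p i) (p j) ∨ p i = p j ∨ Prec (p j) (p i) := by
    intro i j
    rcases lt_trichotomy i j with h | rfl | h
    · exact Or.inl (hp _ _ h)
    · exact Or.inr (Or.inl rfl)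
    · exact Or.inr (Or.inr (hp _ _ h))
  have hlt : ∀ i j : Fin m, Prec (p i) (p j) → i < j := by
    intro i j h
    rcases lt_trichotomy i j with h' | rfl | h'
    · exact h'
    · exact absurd rfl h.2.2
    · exact absurd (hp _ _ h') h.not_prec
  have hpair : ∀ i j : Fin m, ∃ C, 0 ≤ C ∧ ∀ (D : ℕ) (x₁ x₂ : ℤ), x₁ < s i → x₂ < s j →
      ((1 / 4 : ℝ) ^ ((i : ℕ) + 1)) ^ x₁ * ‖-innerTransition a b (r / 4) (p i) x₁ (p j) x₂ +
        ∑ k ∈ Finset.range D, kernelTerm a b (r / 4) r (p i) x₁ (p j) x₂ k‖ ≤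
        ((1 / 4 : ℝ) ^ ((j : ℕ) + 1)) ^ x₂ * (C * (1 / 2) ^ x₂.natAbs) := by
    intro i j
    refine weighted_kernel_le a b (by linarith) (by linarith) hr0 (by linarith) (by nlinarith)
      ((hu4 i).trans_lt (by norm_num)) ?_ (by positivity) ?_ ?_ (s i) (s j)
    · have : r ≤ (1 / 4 : ℝ) ^ ((i : ℕ) + 1) :=
        pow_le_pow_of_le_one (by norm_num) (by norm_num) (by omega)
      linarith
    · rw [le_div_iff₀ (by positivity)]
      have := hu4 j
      linarith
    · intro h
      have hij : (i : ℕ) < j := hlt i j h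
      rw [le_div_iff₀ (by positivity)]
      have h1 : (1 / 4 : ℝ) ^ ((j : ℕ) + 1) ≤ (1 / 4 : ℝ) ^ ((i : ℕ) + 1 + 1) :=
        pow_le_pow_of_le_one (by norm_num) (by norm_num) (by omega)
      have h2 : (0 : ℝ) < (1 / 4) ^ ((i : ℕ) + 1) := by positivity
      rw [pow_succ _ ((i : ℕ) + 1)] at h1
      linarith
  choose C hC0 hC using hpair
  have hCle : ∀ i j, C i j ≤ ∑ i, ∑ j, C i j := fun i j =>
    (Finset.single_le_sum (fun j _ => hC0 i j) (Finset.mem_univ j)).trans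
      (Finset.single_le_sum (f := fun i => ∑ j, C i j)
        (fun i _ => Finset.sum_nonneg fun j _ => hC0 i j) (Finset.mem_univ i))
  have hCs : 0 ≤ ∑ i, ∑ j, C i j := Finset.sum_nonneg fun i _ => Finset.sum_nonneg fun j _ => hC0 i j
  refine ⟨∑ i, ∑ j, C i j, ?_⟩
  have hN : ∀ᶠ N : ℕ in atTop, ∀ i, 0 ≤ (p i).1 + N := by
    refine eventually_all.2 fun i => ?_
    filter_upwards [eventually_ge_atTop (p i).1.natAbs] with N hN
    omega
  filter_upwards [hN] with N hN x y
  obtain ⟨i, x₁⟩ := x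
  obtain ⟨j, x₂⟩ := y
  unfold cutKernel
  simp only
  split_ifs with h1 h2 h2
  · rw [one_mul, mul_one, shiftedKernel_eq a b hρ.1 hρ.2 (ε := r / 4) (r := r) (by linarith)
      (by linarith) hr0 (by linarith) (hcmp i j) (hN i) (hN j)]
    refine (hC i j _ x₁ x₂ h1 h2).trans ?_
    have := hCle i j
    gcongr
  all_goals
    simp only [mul_zero, zero_mul, norm_zero]
    positivity

lemma fredholm_limit (a b : ℝ → ℝ) {ρ r₀ r₁ : ℝ} (hρ : 0 < ρ ∧ ρ < 1) (hr₀ : 0 < r₀ ∧ r₀ < 1)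
    (hr₁ : 0 < r₁ ∧ r₁ < 1) {m : ℕ} (p : Fin m → ℤ × ℝ) (s : Fin m → ℤ)
    (hp : ∀ i j, i < j → Prec (p i) (p j)) :
    (∀ᶠ N : ℕ in atTop, FredholmSummable (cutKernel p s (shiftedKernel a b ρ N))) ∧
      FredholmSummable (cutKernel p s (flatKernel a b r₀ r₁)) ∧
      Tendsto (fun N : ℕ => fredholmDet (cutKernel p s (shiftedKernel a b ρ N)))
        atTop (𝓝 (fredholmDet (cutKernel p s (flatKernel a b r₀ r₁)))) := by
  obtain ⟨C, hC⟩ := eventually_cutKernel_le a b hρ p s hp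
  -- The sign (-1)^(n₁-n₂) factors as c x (c y)⁻¹ with |c| = 1, so neither the bounds nor the
  -- determinants are affected.
  set c : Fin m × ℤ → ℂ := fun x => (-1) ^ (p x.1).1 with hcdef
  have hc : ∀ x, c x ≠ 0 := fun x => zpow_ne_zero _ (by norm_num)
  have hcn : ∀ x, ‖c x‖ = 1 := fun x => by simp [hcdef]
  have hg : Summable fun y : Fin m × ℤ => (1 / 2 : ℝ) ^ y.2.natAbs := by
    have := Summable.mul_of_nonneg (f := fun _ : Fin m => (1 : ℝ))
      (g := fun x : ℤ => (1 / 2 : ℝ) ^ x.natAbs) (Summable.of_finite) summable_half_pow_natAbs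
      (fun _ => zero_le_one) (fun _ => by positivity)
    simpa using this
  have hlim : ∀ x y : Fin m × ℤ, Tendsto
      (fun N : ℕ => c x * cutKernel p s (shiftedKernel a b ρ N) x y * (c y)⁻¹) atTop
      (𝓝 (cutKernel p s (flatKernel a b r₀ r₁) x y)) := by
    intro x y
    have hcmp : Prec (p x.1) (p y.1) ∨ p x.1 = p y.1 ∨ Prec (p y.1) (p x.1) := by
      rcases lt_trichotomy x.1 y.1 with h | h | h
      · exact Or.inl (hp _ _ h)
      · exact Or.inr (Or.inl (by rw [h]))
      · exact Or.inr (Or.inr (hp _ _ h))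
    have h := ((tendsto_shiftedKernel a b hρ hr₀ hr₁ hcmp x.2 y.2).const_mul
      (if x.2 < s x.1 then (1 : ℂ) else 0)).mul_const (if y.2 < s y.1 then (1 : ℂ) else 0)
    refine h.congr fun N => ?_
    unfold cutKernel
    simp only [hcdef]
    rw [zpow_sub₀ (by norm_num : (-1 : ℂ) ≠ 0), div_eq_mul_inv]
    ring
  have h := tendsto_fredholmDet (X := Fin m × ℤ)
    (w := fun x => ((1 / 4 : ℝ) ^ ((x.1 : ℕ) + 1)) ^ x.2)
    (g := fun y => (1 / 2 : ℝ) ^ y.2.natAbs) (C := C) (fun x => by positivity)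
    (fun x => by positivity) hg
    (Kn := fun N x y => c x * cutKernel p s (shiftedKernel a b ρ N) x y * (c y)⁻¹) ?_ hlim
  · simpa only [fredholmSummable_conj _ hc, fredholmDet_conj _ hc] using h
  · filter_upwards [hC] with N hN x y
    simpa only [norm_mul, norm_inv, hcn, one_mul, inv_one, mul_one] using hN x y

end PushASEP
theorem proposition3p5 (a b : ℝ → ℝ) (ρ r₀ r₁ : ℝ)
    (hρ : 0 < ρ ∧ ρ < 1) (hr₀ : 0 < r₀ ∧ r₀ < 1) (hr₁ : 0 < r₁ ∧ r₁ < 1) :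
    (∀ (n : ℤ) (t : ℝ), 1 ≤ n →
      ∃! F, PushASEP.IsDualFamily (fun _ => 1) (fun i => -2 * i) a b ρ n t F) ∧
    (∀ (p q : ℤ × ℝ) (x₁ x₂ : ℤ), PushASEP.Prec p q ∨ p = q ∨ PushASEP.Prec q p →
      Tendsto (fun N : ℕ => (-1 : ℂ) ^ (p.1 - q.1) * PushASEP.shiftedKernel a b ρ N p x₁ q x₂)
        atTop (𝓝 (PushASEP.flatKernel a b r₀ r₁ p x₁ q x₂))) ∧
    (∀ (m : ℕ) (p : Fin m → ℤ × ℝ) (s : Fin m → ℤ),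
      (∀ i j, i < j → PushASEP.Prec (p i) (p j)) →
      (∀ᶠ N : ℕ in atTop, PushASEP.FredholmSummable
        (PushASEP.cutKernel p s (PushASEP.shiftedKernel a b ρ N))) ∧
      PushASEP.FredholmSummable (PushASEP.cutKernel p s (PushASEP.flatKernel a b r₀ r₁)) ∧
      Tendsto (fun N : ℕ => PushASEP.fredholmDet
          (PushASEP.cutKernel p s (PushASEP.shiftedKernel a b ρ N)))
        atTop (𝓝 (PushASEP.fredholmDet
          (PushASEP.cutKernel p s (PushASEP.flatKernel a b r₀ r₁))))) := by
  exact ⟨fun n t _ => PushASEP.existsUnique_isDualFamily a b hρ.1 hρ.2 n t,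
    fun p q x₁ x₂ hpq => PushASEP.tendsto_shiftedKernel a b hρ hr₀ hr₁ hpq x₁ x₂,
    fun m p s hp => PushASEP.fredholm_limit a b hρ hr₀ hr₁ p s hp⟩
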